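/- Let $(X,\omega)$ be a strictly unbounded symplectic toric $4$-manifold: a connected symplectic $4$-manifold with a smooth effective Hamiltonian action of $\mathbb T^2=\mathbb R^2/2\pi\mathbb Z^2$ whose moment map $\mu$ is proper onto its convex image $P=\mu(X)\subset\mathbb R^2$, where the moment polygon $$P=\{x\in\mathbb R^2:\ \langle x,\nu_i\rangle+\lambda_i\ge 0,\ i=1,\dots,d\}$$ has finitely many edges $E_1,\dots,E_d$, with primitive interior normals $\nu_i=(\alpha_i,\beta_i)\in\mathbb Z^2$ (those of two intersecting edges forming a basis of $\mathbb Z^2$), its unbounded edges are $E_1$ and $E_d$, these are not parallel, and the edges are ordered so that $E_{i-1}\cap E_i\neq\emptyset$ and $\det(\nu_{i-1},\nu_i)=-1$ for $i=2,\dots,d$. Let $0\neq\nu=(\alpha,\beta)\in\mathbb R^2$ satisfy $$\det(\nu,\nu_1)>0,\qquad \det(\nu,\nu_d)>0 .$$ For $H\in\mathbb R$, $r>0$ put $$\xi=(\xi_1,\xi_2)=\log(r)\,\nu_1+\tfrac12\sum_{i=1}^{d-1}\log\!\Big(H+a_i+\sqrt{(H+a_i)^2+r^2}\Big)(\nu_{i+1}-\nu_i)+H\,\nu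 ,$$ and let $x=(x_1,x_2)$ be the primitives $$dx_1=r\Big(\frac{\partial\xi_2}{\partial r}dH-\frac{\partial\xi_2}{\partial H}dr\Big),\qquad dx_2=-r\Big(\frac{\partial\xi_1}{\partial r}dH-\frac{\partial\xi_1}{\partial H}dr\Big),$$ extended continuously to $r=0$, where the real numbers $a_1<\dots<a_{d-1}$ and the constants of integration are chosen so that $x(-a_i,0)$ is the vertex $E_i\cap E_{i+1}$ of $P$ for $i=1,\dots,d-1$. Let $\mathbf u$ be a smooth function on the interior $\breve P$ of $P$ with $d\mathbf u=\xi_1dx_1+\xi_2dx_2$, and let $g$ be the generalized Taub-NUT-type metric on $X$ determined by $\nu$, that is, the smooth Riemannian metric on $X$ which in symplectic action-angle coordinates $(x,\theta)$ on $\mu^{-1}(\breve P)\cong\breve P\times\mathbb T^2$ is given by the matrix $$\begin{pmatrix}\operatorname{Hess}_x\mathbf u&0\\0&(\operatorname{Hess}_x\mathbf u)^{-1}\end{pmatrix}.$$ Then $\mathbb R\nu$ is the unique $1$-dimensional subspace of $\operatorname{Lie}(\mathbb T^2)=\mathbb R^2$ all of whose vectors induce vector fields on $X$ of bounded length with respect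 to $g$. That is, a linear subspace $L\subset\operatorname{Lie}(\mathbb T^2)$ is $1$-dimensional and for each $w\in L$ the function $p\mapsto |w_X(p)|_g$ is bounded on $X$, where $w_X(p)=\frac{d}{dt}\big|_{t=0}\exp(tw)\cdot p$, if and only if $L=\mathbb R\nu$. -/

import Mathlib

open scoped Manifold ContDiff Matrix

namespace ToricTaubNUT

/-- The plane `ℝ²`; it serves as the Lie algebra of the torus and as (the dual space containing)
the moment polygon, paired by the standard dot product. -/
abbrev Plane : Type := Fin 2 → ℝ

/-- The model space `ℝ⁴`. -/
abbrev E4 : Type := EuclideanSpace ℝ (Fin 4)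

/-- The standard torus `𝕋² = ℝ² / 2πℤ²`, written additively. -/
abbrev Torus : Type := Fin 2 → AddCircle (2 * Real.pi)

/-- The exponential map (quotient map) `ℝ² = Lie(𝕋²) → 𝕋²`. -/
noncomputable def torusExp (w : Plane) : Torus := fun i => (w i : AddCircle (2 * Real.pi))

/-- `det(v, w)` for vectors of the plane. -/
def det2 (v w : Plane) : ℝ := v 0 * w 1 - v 1 * w 0

/-! ### Polygons -/

/-- The data of a planar region `{x | ∀ i, ⟨x, ν i⟩ + lam i ≥ 0}` with `n + 2` integral normals. -/
structure PolygonData (n : ℕ) where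
  /-- the interior normals -/
  intNormal : Fin (n + 2) → Fin 2 → ℤ
  /-- the constants `lam i` -/
  lam : Fin (n + 2) → ℝ

namespace PolygonData

variable {n : ℕ} (Q : PolygonData n)

/-- The `i`-th interior normal, as a real vector. -/
def normal (i : Fin (n + 2)) : Plane := fun k => (Q.intNormal i k : ℝ)

/-- The affine function `ℓ_i(x) = ⟨x, ν i⟩ + lam i`. -/
def ell (i : Fin (n + 2)) (x : Plane) : ℝ := x ⬝ᵥ Q.normal i + Q.lam i

/-- The polygonal region. -/
def region : Set Plane := {x | ∀ i, 0 ≤ Q.ell i x}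

/-- The `i`-th edge. -/
def edge (i : Fin (n + 2)) : Set Plane := {x | x ∈ Q.region ∧ Q.ell i x = 0}

/-- `Q` presents a moment polygon with `d = n + 2` edges which is strictly unbounded (it has two
non-parallel unbounded edges), with its edges `E 0, …, E (n + 1)` in their standard order. Having
two non-parallel unbounded edges forces at least two edges, so nothing is lost by counting the edges
as `n + 2`. -/
structure IsStrictlyUnbounded : Prop where
  /-- every listed half-plane contributes a genuine (non-degenerate) edge -/
  edge_nontrivial : ∀ i, (Q.edge i).Nontrivial
  /-- different indices give different edges -/
  edge_injective : Function.Injective Q.edge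
  /-- the normals are primitive vectors of `ℤ²` -/
  primitive : ∀ i, IsCoprime (Q.intNormal i 0) (Q.intNormal i 1)
  /-- the normals of two intersecting edges form a basis of `ℤ²` -/
  smooth : ∀ i j, i ≠ j → (Q.edge i ∩ Q.edge j).Nonempty → |det2 (Q.normal i) (Q.normal j)| = 1
  /-- the unbounded edges are exactly the first and the last one -/
  unbounded_iff : ∀ i, ¬ Bornology.IsBounded (Q.edge i) ↔ (i = 0 ∨ i = Fin.last (n + 1))
  /-- consecutive edges meet -/
  consecutive_meet : ∀ i : Fin (n + 1), (Q.edge i.castSucc ∩ Q.edge i.succ).Nonempty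
  /-- the ordering convention `det(ν i, ν (i + 1)) = -1` -/
  consecutive_det : ∀ i : Fin (n + 1), det2 (Q.normal i.castSucc) (Q.normal i.succ) = -1
  /-- the two unbounded edges are not parallel -/
  not_parallel : det2 (Q.normal 0) (Q.normal (Fin.last (n + 1))) ≠ 0

end PolygonData

/-! ### Symplectic toric 4-manifolds -/

section Manifold

variable {X : Type*} [TopologicalSpace X] [ChartedSpace E4 X]

/-- A field of alternating bilinear forms on the tangent spaces of `X`. -/
abbrev TwoForm (X : Type*) [TopologicalSpace X] [ChartedSpace E4 X] : Type _ :=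
  (p : X) → (TangentSpace (𝓡 4) p) [⋀^Fin 2]→L[ℝ] ℝ

/-- The expression of a 2-form in a chart, i.e. its pullback by the inverse of the chart. -/
noncomputable def localForm (σ : TwoForm X) (e : OpenPartialHomeomorph X E4) :
    E4 → E4 [⋀^Fin 2]→L[ℝ] ℝ :=
  fun y => (σ (e.symm y)).compContinuousLinearMap (mfderiv 𝓘(ℝ, E4) (𝓡 4) e.symm y)

/-- `σ` is a symplectic form: smooth, closed and non-degenerate. -/
structure IsSymplectic (σ : TwoForm X) : Prop where
  smooth : ∀ e ∈ IsManifold.maximalAtlas (𝓡 4) ∞ X, ContDiffOn ℝ ∞ (localForm σ e) e.target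
  closed : ∀ e ∈ IsManifold.maximalAtlas (𝓡 4) ∞ X, ∀ y ∈ e.target, extDeriv (localForm σ e) y = 0
  nondegenerate : ∀ (p : X) (v : TangentSpace (𝓡 4) p),
    (∀ w : TangentSpace (𝓡 4) p, σ p ![v, w] = 0) → v = 0

variable [AddAction Torus X]

/-- The vector field on `X` induced by `w ∈ Lie(𝕋²)`: the velocity at `t = 0` of
`t ↦ exp(t w) · p`. -/
noncomputable def inducedField (w : Plane) (p : X) : TangentSpace (𝓡 4) p :=
  (mfderiv 𝓘(ℝ, ℝ) (𝓡 4) (fun t : ℝ => torusExp (t • w) +ᵥ p) 0 (1 : ℝ) : E4)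

/-- The connected manifold `X` with the 2-form `σ`, the given action of `𝕋²` and the map `μ` is a
symplectic toric 4-manifold: `σ` is symplectic, the action is smooth, effective and Hamiltonian with
moment map `μ`, and `μ` is proper onto its convex image. -/
structure IsSymplecticToric (σ : TwoForm X) (μ : X → Plane) : Prop where
  symplectic : IsSymplectic σ
  /-- the action is smooth (`ℝ² → 𝕋²` being a local diffeomorphism, this may be tested on `ℝ²`) -/
  smooth_action : ContMDiff (𝓘(ℝ, Plane).prod (𝓡 4)) (𝓡 4) ∞
    (fun q : Plane × X => torusExp q.1 +ᵥ q.2)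
  effective : FaithfulVAdd Torus X
  /-- the torus acts by symplectomorphisms -/
  invariant : ∀ (θ : Torus) (p : X) (v w : TangentSpace (𝓡 4) p),
    σ (θ +ᵥ p) ![mfderiv (𝓡 4) (𝓡 4) (fun q : X => θ +ᵥ q) p v,
      mfderiv (𝓡 4) (𝓡 4) (fun q : X => θ +ᵥ q) p w] = σ p ![v, w]
  smooth_moment : ContMDiff (𝓡 4) 𝓘(ℝ, Plane) ∞ μ
  moment_invariant : ∀ (θ : Torus) (p : X), μ (θ +ᵥ p) = μ p
  /-- `d⟨μ, w⟩ = σ(·, w_X)`, the sign being that of `σ = ∑ dx_i ∧ dθ_i`, `μ = x` -/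
  hamiltonian : ∀ (p : X) (w : Plane) (v : TangentSpace (𝓡 4) p),
    (mfderiv (𝓡 4) 𝓘(ℝ, Plane) μ p v : Plane) ⬝ᵥ w = σ p ![v, inducedField w p]
  convex_image : Convex ℝ (Set.range μ)
  proper_onto_image : IsProperMap (Set.rangeFactorization μ)

/-- `Φ (x, θ)` are symplectic action-angle coordinates on the part of `X` over the interior of the
moment image: `Φ` induces an equivariant symplectic diffeomorphism
`(interior P) × 𝕋² ≅ μ⁻¹ (interior P)` with `μ (Φ (x, θ)) = x`; the angle `θ` is written in `ℝ²`
instead of `𝕋²`. -/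
structure IsActionAngle (σ : TwoForm X) (μ : X → Plane) (P : Set Plane)
    (Φ : Plane × Plane → X) : Prop where
  smooth : ContMDiffOn 𝓘(ℝ, Plane × Plane) (𝓡 4) ∞ Φ (interior P ×ˢ Set.univ)
  equivariant : ∀ x ∈ interior P, ∀ θ t : Plane, Φ (x, θ + t) = torusExp t +ᵥ Φ (x, θ)
  moment : ∀ x ∈ interior P, ∀ θ : Plane, μ (Φ (x, θ)) = x
  injective : ∀ x ∈ interior P, ∀ θ θ' : Plane, Φ (x, θ) = Φ (x, θ') → torusExp θ = torusExp θ'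
  surjective : ∀ p : X, μ p ∈ interior P → ∃ θ : Plane, Φ (μ p, θ) = p
  symplectic : ∀ x ∈ interior P, ∀ θ : Plane, ∀ v w : Plane × Plane,
    σ (Φ (x, θ)) ![mfderiv 𝓘(ℝ, Plane × Plane) (𝓡 4) Φ (x, θ) v,
      mfderiv 𝓘(ℝ, Plane × Plane) (𝓡 4) Φ (x, θ) w] = v.1 ⬝ᵥ w.2 - w.1 ⬝ᵥ v.2

end Manifold

/-! ### The metrics -/

section Metric

variable {n : ℕ}

/-- The functions `ξ_1, ξ_2` of `(H, r)`, `r > 0`, as the components of a vector: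
`ξ = log r • ν_1 + 1/2 ∑ log (H + a_i + √((H + a_i)² + r²)) • (ν_{i+1} - ν_i) + H • ν`. -/
noncomputable def xi (Q : PolygonData n) (ν : Plane) (a : Fin (n + 1) → ℝ) (h : ℝ × ℝ) : Plane :=
  Real.log h.2 • Q.normal 0
    + (1 / 2 : ℝ) • ∑ i : Fin (n + 1),
        Real.log (h.1 + a i + Real.sqrt ((h.1 + a i) ^ 2 + h.2 ^ 2)) •
          (Q.normal i.succ - Q.normal i.castSucc)
    + h.1 • ν

/-- The partial derivative `∂ξ_k/∂H`. -/
noncomputable def xiH (Q : PolygonData n) (ν : Plane) (a : Fin (n + 1) → ℝ) (k : Fin 2)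
    (h : ℝ × ℝ) : ℝ :=
  deriv (fun H => xi Q ν a (H, h.2) k) h.1

/-- The partial derivative `∂ξ_k/∂r`. -/
noncomputable def xiR (Q : PolygonData n) (ν : Plane) (a : Fin (n + 1) → ℝ) (k : Fin 2)
    (h : ℝ × ℝ) : ℝ :=
  deriv (fun r => xi Q ν a (h.1, r) k) h.2

/-- The constants `a_i` and the function `x = (x_1, x_2)` of `(H, r)`, `r ≥ 0`, are adapted to the
polygon: `dx_1 = r (ξ_{2,r} dH - ξ_{2,H} dr)` and `dx_2 = - r (ξ_{1,r} dH - ξ_{1,H} dr)` for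
`r > 0`, `x` is continuous up to `r = 0`, and the boundary point `(-a_i, 0)` is sent to the `i`-th
vertex of the polygon. -/
structure IsActionMap (Q : PolygonData n) (ν : Plane) (a : Fin (n + 1) → ℝ)
    (x : ℝ × ℝ → Plane) : Prop where
  strictMono : StrictMono a
  continuousOn : ContinuousOn x {h | 0 ≤ h.2}
  primitive_fst : ∀ h : ℝ × ℝ, 0 < h.2 → HasFDerivAt (fun q => x q 0)
    (h.2 • (xiR Q ν a 1 h • ContinuousLinearMap.fst ℝ ℝ ℝ
      - xiH Q ν a 1 h • ContinuousLinearMap.snd ℝ ℝ ℝ)) h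
  primitive_snd : ∀ h : ℝ × ℝ, 0 < h.2 → HasFDerivAt (fun q => x q 1)
    (-h.2 • (xiR Q ν a 0 h • ContinuousLinearMap.fst ℝ ℝ ℝ
      - xiH Q ν a 0 h • ContinuousLinearMap.snd ℝ ℝ ℝ)) h
  vertex : ∀ i : Fin (n + 1), x (-a i, 0) ∈ Q.edge i.castSucc ∩ Q.edge i.succ

/-- The Hessian matrix of a function on the plane. -/
noncomputable def hess (u : Plane → ℝ) (x : Plane) : Matrix (Fin 2) (Fin 2) ℝ :=
  Matrix.of fun j k => fderiv ℝ (fun y => fderiv ℝ u y (Pi.single k 1)) x (Pi.single j 1)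

/-- `u`, smooth on the interior of the polygon, is a primitive of `ξ_1 dx_1 + ξ_2 dx_2`. -/
structure IsPotential (Q : PolygonData n) (ν : Plane) (a : Fin (n + 1) → ℝ)
    (x : ℝ × ℝ → Plane) (u : Plane → ℝ) : Prop where
  smooth : ContDiffOn ℝ ∞ u (interior Q.region)
  differential : ∀ h : ℝ × ℝ, 0 < h.2 → x h ∈ interior Q.region →
    ∀ v : Plane, fderiv ℝ u (x h) v = xi Q ν a h ⬝ᵥ v

variable {X : Type*} [TopologicalSpace X] [ChartedSpace E4 X] [IsManifold (𝓡 4) ∞ X]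
  [AddAction Torus X]

/-- Smooth Riemannian metrics on `X`. -/
abbrev Metric (X : Type*) [TopologicalSpace X] [ChartedSpace E4 X] [IsManifold (𝓡 4) ∞ X] :
    Type _ :=
  Bundle.ContMDiffRiemannianMetric (IB := 𝓡 4) (n := ∞) (F := E4)
    (E := fun p : X => TangentSpace (𝓡 4) p)

/-- `g` is the toric Kähler metric on `X` attached to the vector `ν`: over the interior of the
moment polygon it is given in action-angle coordinates `(x, θ)` by the matrix
`diag (Hess u, (Hess u)⁻¹)`, where `u` is the symplectic potential with `du = ξ_1 dx_1 + ξ_2 dx_2`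
defined by `ν`. -/
def IsMetricOf (Q : PolygonData n) (ν : Plane) (σ : TwoForm X) (μ : X → Plane)
    (g : Metric X) : Prop :=
  ∃ (a : Fin (n + 1) → ℝ) (x : ℝ × ℝ → Plane) (u : Plane → ℝ) (Φ : Plane × Plane → X),
    IsActionMap Q ν a x ∧ IsPotential Q ν a x u ∧ IsActionAngle σ μ Q.region Φ ∧
    ∀ y ∈ interior Q.region, ∀ θ : Plane, ∀ v w : Plane × Plane,
      g.inner (Φ (y, θ)) (mfderiv 𝓘(ℝ, Plane × Plane) (𝓡 4) Φ (y, θ) v)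
        (mfderiv 𝓘(ℝ, Plane × Plane) (𝓡 4) Φ (y, θ) w)
        = v.1 ⬝ᵥ (hess u y *ᵥ w.1) + v.2 ⬝ᵥ ((hess u y)⁻¹ *ᵥ w.2)

/-- The vector field on `X` induced by `w ∈ Lie(𝕋²)` has bounded length with respect to `g`. -/
def HasBoundedLength (g : Metric X) (w : Plane) : Prop :=
  ∃ C : ℝ, ∀ p : X, Real.sqrt (g.inner p (inducedField w p) (inducedField w p)) ≤ C

end Metric

end ToricTaubNUT

/-!
Let `V = ∂ξ/∂H` and `A = r ∂ξ/∂r`. Since `∇u ∘ x = ξ`, the chain rule gives the inverse Hessian of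
the potential at `x(H, r)` in closed form:
`⟨w, (Hess u)⁻¹ w⟩ = (r² det(w, V)² + det(w, A)²) / det(V, A)`
(`IsPotential.dotProduct_inv_hess`). Over the interior of the polygon this is the squared length of
the vector field induced by `w`, and everything rests on the size of the three determinants.

* The vector `A` is a convex combination of the normals (`radialGradR_eq_sum`), so it is bounded, and
  `det(ν, A)` is bounded below by a positive constant, because the unboundedness of the first and the
  last edge forces all normals into the cone spanned by the first and the last one
  (`PolygonData.IsStrictlyUnbounded.det2_pos`).
* `det(V, A) ≥ det(ν, A)` (`det2_le_det2_gradH`). The difference is, after summation by parts, a sum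
  over pairs of normals in which the coefficients of `V - ν` and of `A` are the height and width
  differences of successive points of the unit half-circle. Its sign is therefore given by two facts:
  the slopes of the chords decrease, and the normals turn clockwise.
* `r (V - ν)` is bounded, so `r det(ν, V)` is bounded whereas `r det(w, V)` grows like `r det(w, ν)`.

Hence the quadratic form is bounded for `w = ν`, and for `w ∉ ℝν` it is unbounded along `H = 0`,
`r → ∞`.

To turn this into a statement on the whole of the polygon, `x` has to map the open half-plane onto
its interior (`IsActionMap.image_eq`). With the conjugate functions of the logarithms in `ξ`, each
`ℓ_j ∘ x` becomes a sum of terms which are non-negative by the triangle inequality for the distances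
`ρ_i`, plus `r² det(ν, ν_j) / 2` (`IsActionMap.ell_eq`). So `x` maps into the interior and is proper;
it is a local diffeomorphism since `det(V, A) > 0`, and the interior is connected.

To pass from the interior of the polygon to all of `X`, the squared length is continuous, and the
points over the interior are dense (`IsSymplecticToric.dense_preimage_interior`): if an open set were
mapped into the line of an edge, the circle subgroup generated by the normal of that edge would fix
it pointwise, and then its element of order two, an involution of a connected manifold, would be
trivial (`eq_self_of_involution`), against effectiveness.
-/

namespace ToricTaubNUT

/-! ### The determinant of two plane vectors -/

theorem det2_add_right (v w w' : Plane) : det2 v (w + w') = det2 v w + det2 v w' := by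
  simp only [det2, Pi.add_apply]; ring

theorem det2_sub_right (v w w' : Plane) : det2 v (w - w') = det2 v w - det2 v w' := by
  simp only [det2, Pi.sub_apply]; ring

theorem det2_smul_right (c : ℝ) (v w : Plane) : det2 v (c • w) = c * det2 v w := by
  simp only [det2, Pi.smul_apply, smul_eq_mul]; ring

theorem det2_swap (v w : Plane) : det2 v w = -det2 w v := by
  simp only [det2]; ring

theorem det2_self (v : Plane) : det2 v v = 0 := by
  simp only [det2]; ring

theorem det2_add_left (v v' w : Plane) : det2 (v + v') w = det2 v w + det2 v' w := by
  simp only [det2, Pi.add_apply]; ring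

theorem det2_smul_left (c : ℝ) (v w : Plane) : det2 (c • v) w = c * det2 v w := by
  simp only [det2, Pi.smul_apply, smul_eq_mul]; ring

theorem det2_sum_right {ι : Type*} (s : Finset ι) (v : Plane) (f : ι → Plane) :
    det2 v (∑ i ∈ s, f i) = ∑ i ∈ s, det2 v (f i) := by
  simp only [det2, Finset.sum_apply, Finset.mul_sum, Finset.sum_sub_distrib]

theorem det2_sum_left {ι : Type*} (s : Finset ι) (v : Plane) (f : ι → Plane) :
    det2 (∑ i ∈ s, f i) v = ∑ i ∈ s, det2 (f i) v := by
  simp only [det2, Finset.sum_apply, Finset.sum_mul, Finset.sum_sub_distrib]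

/-- The Plücker relation in the plane. -/
theorem det2_plucker (v a b c : Plane) :
    det2 v b * det2 a c = det2 v a * det2 b c + det2 v c * det2 a b := by
  simp only [det2]; ring

theorem mem_span_singleton_of_det2_eq_zero {v w : Plane} (hv : v ≠ 0) (h : det2 v w = 0) :
    w ∈ Submodule.span ℝ {v} := by
  rw [Submodule.mem_span_singleton]
  simp only [det2] at h
  by_cases h0 : v 0 = 0
  · have h1 : v 1 ≠ 0 := by
      intro h1
      exact hv (by ext i; fin_cases i <;> simp [h0, h1])
    refine ⟨w 1 / v 1, ?_⟩
    have hw : w 0 = 0 := by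
      rw [h0] at h
      have : v 1 * w 0 = 0 := by linarith
      exact (mul_eq_zero.mp this).resolve_left h1
    ext i; fin_cases i
    · simp [h0, hw]
    · simp [h1]
  · refine ⟨w 0 / v 0, ?_⟩
    ext i; fin_cases i
    · simp [h0]
    · simp only [Fin.mk_one, Pi.smul_apply, smul_eq_mul]
      field_simp
      linarith

/-! ### The normals of a strictly unbounded polygon -/

namespace PolygonData

variable {n : ℕ} {Q : PolygonData n}

theorem ell_sub_ell (j : Fin (n + 2)) (y z : Plane) :
    Q.ell j y - Q.ell j z = (y - z) ⬝ᵥ Q.normal j := by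
  simp only [ell, sub_dotProduct]; ring

/-- If the edge `E_i` is unbounded, then it recedes to the side of any neighbouring edge `E_k`, so
that `det(ν_i, ν_j)` cannot have the sign opposite to `det(ν_i, ν_k)`. -/
theorem mul_det2_nonneg_of_not_isBounded {i k : Fin (n + 2)} (j : Fin (n + 2))
    (hi : ¬ Bornology.IsBounded (Q.edge i)) (hik : (Q.edge i ∩ Q.edge k).Nonempty)
    (hdet : det2 (Q.normal i) (Q.normal k) ≠ 0) :
    0 ≤ det2 (Q.normal i) (Q.normal k) * det2 (Q.normal i) (Q.normal j) := by
  by_contra hneg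
  push Not at hneg
  apply hi
  obtain ⟨v, hvi, hvk⟩ := hik
  set ε := det2 (Q.normal i) (Q.normal k) with hε
  set δ := det2 (Q.normal i) (Q.normal j) with hδ
  let γ : ℝ → Plane := fun t => v + t • ![-Q.normal i 1, Q.normal i 0]
  have hγ : Continuous γ := by fun_prop
  have hcomp : IsCompact (γ '' (Set.uIcc 0 (-(Q.ell j v / δ)))) := isCompact_uIcc.image hγ
  refine hcomp.isBounded.subset ?_
  intro y hy
  have h1 : (y - v) ⬝ᵥ Q.normal i = 0 := by
    rw [← ell_sub_ell, hy.2, hvi.2, sub_zero]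
  have h2 : (y - v) ⬝ᵥ Q.normal k = Q.ell k y := by
    rw [← ell_sub_ell, hvk.2, sub_zero]
  have h3 := ell_sub_ell (Q := Q) j y v
  have hk : 0 ≤ Q.ell k y := hy.1 k
  have hj : 0 ≤ Q.ell j y := hy.1 j
  have hvj : 0 ≤ Q.ell j v := hvi.1 j
  set t := Q.ell k y / ε with ht
  have hyγ : y = γ t := by
    simp only [dotProduct, Fin.sum_univ_two, Pi.sub_apply] at h1 h2
    ext m; fin_cases m
    · simp only [γ, ht, Pi.add_apply, Pi.smul_apply, smul_eq_mul, Fin.zero_eta, Matrix.cons_val_zero]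
      field_simp
      rw [← h2, hε, det2]
      linear_combination (Q.normal k 1) * h1
    · simp only [γ, ht, Pi.add_apply, Pi.smul_apply, smul_eq_mul, Fin.mk_one, Matrix.cons_val_one]
      field_simp
      rw [← h2, hε, det2]
      simp
      linear_combination (-Q.normal k 0) * h1
  have hjt : Q.ell j y = Q.ell j v + t * δ := by
    have : (y - v) ⬝ᵥ Q.normal j = t * δ := by
      rw [hyγ]
      simp only [γ, add_sub_cancel_left, Pi.smul_apply, hδ, det2, dotProduct,
        Fin.sum_univ_two, smul_eq_mul, Matrix.cons_val_zero, Matrix.cons_val_one]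
      ring
    linarith
  refine ⟨t, ?_, hyγ.symm⟩
  rw [Set.mem_uIcc]
  rcases lt_or_gt_of_ne hdet with hε0 | hε0
  · have hδ0 : 0 < δ := by
      by_contra h; push Not at h
      nlinarith [mul_nonneg_of_nonpos_of_nonpos hε0.le h]
    right
    refine ⟨?_, div_nonpos_of_nonneg_of_nonpos hk hε0.le⟩
    rw [← neg_div, div_le_iff₀ hδ0]; linarith
  · have hδ0 : δ < 0 := by
      by_contra h; push Not at h
      nlinarith [mul_nonneg hε0.le h]
    left
    refine ⟨div_nonneg hk hε0.le, ?_⟩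
    rw [← neg_div, le_div_iff_of_neg hδ0]; linarith

theorem IsStrictlyUnbounded.normal_ne_zero (hQ : Q.IsStrictlyUnbounded) (j : Fin (n + 2)) :
    Q.normal j ≠ 0 := by
  intro h
  have h0 : Q.intNormal j 0 = 0 := by
    have := congrFun h 0
    simpa [normal] using this
  have h1 : Q.intNormal j 1 = 0 := by
    have := congrFun h 1
    simpa [normal] using this
  have := hQ.primitive j
  rw [h0, h1] at this
  simp [isCoprime_zero_left] at this

theorem IsStrictlyUnbounded.det2_first_nonpos (hQ : Q.IsStrictlyUnbounded) (j : Fin (n + 2)) :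
    det2 (Q.normal 0) (Q.normal j) ≤ 0 := by
  have hd := hQ.consecutive_det 0
  rw [Fin.castSucc_zero] at hd
  have hm := hQ.consecutive_meet 0
  rw [Fin.castSucc_zero] at hm
  have := mul_det2_nonneg_of_not_isBounded j ((hQ.unbounded_iff 0).2 (Or.inl rfl)) hm
    (by rw [hd]; norm_num)
  rw [hd] at this
  linarith

theorem IsStrictlyUnbounded.det2_last_nonpos (hQ : Q.IsStrictlyUnbounded) (j : Fin (n + 2)) :
    det2 (Q.normal j) (Q.normal (Fin.last (n + 1))) ≤ 0 := by
  have hd := hQ.consecutive_det (Fin.last n)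
  rw [Fin.succ_last] at hd
  have hm := hQ.consecutive_meet (Fin.last n)
  rw [Fin.succ_last, Set.inter_comm] at hm
  rw [det2_swap] at hd
  have := mul_det2_nonneg_of_not_isBounded j
    ((hQ.unbounded_iff (Fin.last (n + 1))).2 (Or.inr rfl)) hm (by intro h; rw [h] at hd; norm_num at hd)
  rw [det2_swap]
  have h1 : det2 (Q.normal (Fin.last (n + 1))) (Q.normal (Fin.last n).castSucc) = 1 := by linarith
  rw [h1] at this
  linarith

theorem IsStrictlyUnbounded.det2_first_last_neg (hQ : Q.IsStrictlyUnbounded) :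
    det2 (Q.normal 0) (Q.normal (Fin.last (n + 1))) < 0 :=
  lt_of_le_of_ne (hQ.det2_first_nonpos _) hQ.not_parallel

/-- All normals lie in the cone spanned by the first and the last one, so a vector that is
positively oriented against these two is positively oriented against all normals. -/
theorem IsStrictlyUnbounded.det2_pos (hQ : Q.IsStrictlyUnbounded) {ν : Plane}
    (h0 : 0 < det2 ν (Q.normal 0)) (hl : 0 < det2 ν (Q.normal (Fin.last (n + 1))))
    (j : Fin (n + 2)) : 0 < det2 ν (Q.normal j) := by
  have hc := hQ.det2_first_last_neg
  have h1 := hQ.det2_first_nonpos j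
  have h2 := hQ.det2_last_nonpos j
  have key := det2_plucker ν (Q.normal 0) (Q.normal j) (Q.normal (Fin.last (n + 1)))
  by_contra hneg
  push Not at hneg
  have h3 := mul_nonneg_of_nonpos_of_nonpos hneg hc.le
  have h4 := mul_nonpos_of_nonneg_of_nonpos h0.le h2
  have h5 := mul_nonpos_of_nonneg_of_nonpos hl.le h1
  have h6 : det2 (Q.normal j) (Q.normal (Fin.last (n + 1))) = 0 := by
    have : det2 ν (Q.normal 0) * det2 (Q.normal j) (Q.normal (Fin.last (n + 1))) = 0 := by linarith
    exact (mul_eq_zero.mp this).resolve_left h0.ne'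
  have h7 : det2 (Q.normal 0) (Q.normal j) = 0 := by
    have : det2 ν (Q.normal (Fin.last (n + 1))) * det2 (Q.normal 0) (Q.normal j) = 0 := by linarith
    exact (mul_eq_zero.mp this).resolve_left hl.ne'
  apply hQ.normal_ne_zero j
  simp only [det2] at h6 h7 hc
  ext m; fin_cases m
  · refine (mul_eq_zero.mp (?_ : _ * Q.normal j 0 = 0)).resolve_left hc.ne
    linear_combination (Q.normal 0 0) * h6 + (Q.normal (Fin.last (n + 1)) 0) * h7
  · refine (mul_eq_zero.mp (?_ : _ * Q.normal j 1 = 0)).resolve_left hc.ne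
    linear_combination (Q.normal 0 1) * h6 + (Q.normal (Fin.last (n + 1)) 1) * h7

/-- The normals turn clockwise, by less than a half-turn in total. -/
theorem IsStrictlyUnbounded.det2_neg_of_lt (hQ : Q.IsStrictlyUnbounded) {ν : Plane}
    (hpos : ∀ j, 0 < det2 ν (Q.normal j)) {i j : Fin (n + 2)} (hij : i < j) :
    det2 (Q.normal i) (Q.normal j) < 0 := by
  induction j using Fin.induction with
  | zero => exact absurd hij (Fin.not_lt_zero i)
  | succ k ih =>
    rcases (Fin.le_castSucc_iff.2 hij).eq_or_lt with h | h
    · rw [h, hQ.consecutive_det k]; norm_num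
    · have key := det2_plucker ν (Q.normal i) (Q.normal k.castSucc) (Q.normal k.succ)
      rw [hQ.consecutive_det k] at key
      have h1 := mul_neg_of_pos_of_neg (hpos k.succ) (ih h)
      have h2 := hpos i
      by_contra hneg
      push Not at hneg
      have := mul_nonneg (hpos k.castSucc).le hneg
      linarith

theorem continuous_ell (j : Fin (n + 2)) : Continuous (Q.ell j) := by
  unfold ell dotProduct
  fun_prop

/-- The interior of the region is cut out by the strict inequalities. -/
theorem IsStrictlyUnbounded.interior_region (hQ : Q.IsStrictlyUnbounded) :
    interior Q.region = {y | ∀ j, 0 < Q.ell j y} := by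
  apply Set.Subset.antisymm
  · intro y hy j
    have hyr := interior_subset hy
    refine lt_of_le_of_ne (hyr j) fun h0 => ?_
    -- moving against the normal would leave the region
    have hc : ContinuousAt (fun t : ℝ => y - t • Q.normal j) 0 := by fun_prop
    have hmem : ∀ᶠ t in nhds (0 : ℝ), y - t • Q.normal j ∈ Q.region := by
      apply hc
      simpa using mem_interior_iff_mem_nhds.1 hy
    obtain ⟨t, ht, hty⟩ := (hmem.filter_mono nhdsWithin_le_nhds |>.and
      (self_mem_nhdsWithin : Set.Ioi (0 : ℝ) ∈ nhdsWithin 0 (Set.Ioi 0))).exists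
    have h1 := ht j
    have h2 := ell_sub_ell (Q := Q) j (y - t • Q.normal j) y
    have h3 : 0 < Q.normal j ⬝ᵥ Q.normal j := by
      have := (hQ.normal_ne_zero j)
      have h4 : Q.normal j ⬝ᵥ Q.normal j ≠ 0 := fun h => this (dotProduct_self_eq_zero.1 h)
      have h5 : 0 ≤ Q.normal j ⬝ᵥ Q.normal j := by
        simp only [dotProduct, Fin.sum_univ_two]
        exact add_nonneg (mul_self_nonneg _) (mul_self_nonneg _)
      exact lt_of_le_of_ne h5 h4.symm
    have h4 : (y - t • Q.normal j - y) ⬝ᵥ Q.normal j = -(t * (Q.normal j ⬝ᵥ Q.normal j)) := by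
      rw [sub_sub_cancel_left, neg_dotProduct, smul_dotProduct, smul_eq_mul]
    have := mul_pos (Set.mem_Ioi.1 hty) h3
    linarith
  · apply interior_maximal
    · exact fun y hy j => (hy j).le
    · simp only [Set.ofPred_forall]
      exact isOpen_iInter_of_finite fun j => isOpen_lt continuous_const (continuous_ell j)

theorem convex_region : Convex ℝ Q.region := by
  intro y hy z hz s t hs ht hst j
  have : Q.ell j (s • y + t • z) = s * Q.ell j y + t * Q.ell j z := by
    simp only [ell, add_dotProduct, smul_dotProduct, smul_eq_mul]
    linear_combination (-Q.lam j) * hst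
  rw [this]
  exact add_nonneg (mul_nonneg hs (hy j)) (mul_nonneg ht (hz j))

end PolygonData

/-! ### Summation by parts along the chain of edges -/

theorem forall_fin_of_first_of_last_of_mid {n : ℕ} {P : Fin (n + 2) → Prop} (h0 : P 0)
    (hl : P (Fin.last (n + 1))) (hm : ∀ i : Fin n, P i.castSucc.succ) (k : Fin (n + 2)) : P k :=
  Fin.cases h0 (fun i => Fin.lastCases (motive := fun i => P i.succ) hl hm i) k

/-- The finite sequence `b`, with one value prepended and one value appended. -/
def padEnds {n : ℕ} (b₀ : ℝ) (b : Fin (n + 1) → ℝ) (b₁ : ℝ) : Fin (n + 3) → ℝ :=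
  Fin.cons (α := fun _ => ℝ) b₀ (Fin.snoc (α := fun _ => ℝ) b b₁)

section padEnds

variable {n : ℕ} (b₀ : ℝ) (b : Fin (n + 1) → ℝ) (b₁ : ℝ)

theorem padEnds_castSucc_zero : padEnds b₀ b b₁ (0 : Fin (n + 2)).castSucc = b₀ := rfl

theorem padEnds_castSucc_succ (i : Fin (n + 1)) : padEnds b₀ b b₁ i.castSucc.succ = b i := by
  simp only [padEnds, Fin.cons_succ]
  exact Fin.snoc_castSucc (α := fun _ => ℝ) _ _ _

theorem padEnds_succ_castSucc (i : Fin (n + 1)) : padEnds b₀ b b₁ i.succ.castSucc = b i :=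
  padEnds_castSucc_succ b₀ b b₁ i

theorem padEnds_succ_last : padEnds b₀ b b₁ (Fin.last (n + 1)).succ = b₁ := by
  simp only [padEnds, Fin.cons_succ]
  exact Fin.snoc_last (α := fun _ => ℝ) _ _

theorem padEnds_succ_zero : padEnds b₀ b b₁ (0 : Fin (n + 2)).succ = b 0 :=
  padEnds_castSucc_succ b₀ b b₁ 0

theorem padEnds_castSucc_last :
    padEnds b₀ b b₁ (Fin.last (n + 1)).castSucc = b (Fin.last n) :=
  padEnds_succ_castSucc b₀ b b₁ (Fin.last n)

theorem padEnds_mid_castSucc (i : Fin n) :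
    padEnds b₀ b b₁ i.castSucc.succ.castSucc = b i.castSucc :=
  padEnds_succ_castSucc b₀ b b₁ i.castSucc

theorem padEnds_mid_succ (i : Fin n) :
    padEnds b₀ b b₁ i.castSucc.succ.succ = b i.succ :=
  padEnds_castSucc_succ b₀ b b₁ i.succ

theorem sum_padEnds_sub_smul {M : Type*} [AddCommGroup M] [Module ℝ M] (N : Fin (n + 2) → M) :
    ∑ k : Fin (n + 2), (padEnds b₀ b b₁ k.succ - padEnds b₀ b b₁ k.castSucc) • N k
      = b₁ • N (Fin.last (n + 1)) - b₀ • N 0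
        - ∑ i : Fin (n + 1), b i • (N i.succ - N i.castSucc) := by
  simp only [sub_smul, smul_sub, Finset.sum_sub_distrib]
  rw [Fin.sum_univ_castSucc (fun k : Fin (n + 2) => padEnds b₀ b b₁ k.succ • N k),
    Fin.sum_univ_succ (fun k : Fin (n + 2) => padEnds b₀ b b₁ k.castSucc • N k)]
  simp only [padEnds_castSucc_zero, padEnds_castSucc_succ, padEnds_succ_castSucc, padEnds_succ_last]
  abel

end padEnds

/-- Chords of the upper unit half-circle have decreasing slopes. -/
theorem chord_slope_le {s₁ s₂ s₃ t₁ t₂ t₃ : ℝ} (h₁ : s₁ ^ 2 + t₁ ^ 2 = 1) (h₂ : s₂ ^ 2 + t₂ ^ 2 = 1)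
    (h₃ : s₃ ^ 2 + t₃ ^ 2 = 1) (ht₂ : 0 ≤ t₂) (h₁₂ : s₁ < s₂) (h₂₃ : s₂ < s₃) :
    (t₃ - t₂) / (s₃ - s₂) ≤ (t₂ - t₁) / (s₂ - s₁) := by
  rw [div_le_div_iff₀ (sub_pos.2 h₂₃) (sub_pos.2 h₁₂)]
  have key : t₁ * (s₃ - s₂) + t₃ * (s₂ - s₁) ≤ t₂ * (s₃ - s₁) := by
    refine (abs_le_of_sq_le_sq' ?_ (mul_nonneg ht₂ (by linarith))).2
    have hp : 0 ≤ (s₃ - s₂) * (s₂ - s₁) :=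
      mul_nonneg (sub_nonneg.2 h₂₃.le) (sub_nonneg.2 h₁₂.le)
    have hd : s₁ * s₃ + t₁ * t₃ ≤ 1 := by
      nlinarith [sq_nonneg (s₁ - s₃), sq_nonneg (t₁ - t₃)]
    have := mul_nonneg hp (sub_nonneg.2 hd)
    have e : (t₂ * (s₃ - s₁)) ^ 2 - (t₁ * (s₃ - s₂) + t₃ * (s₂ - s₁)) ^ 2
        = 2 * ((s₃ - s₂) * (s₂ - s₁) * (1 - (s₁ * s₃ + t₁ * t₃))) := by
      linear_combination (s₃ - s₁) ^ 2 * h₂ - (s₃ - s₂) ^ 2 * h₁ - (s₂ - s₁) ^ 2 * h₃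
    linarith
  linarith

/-- If the vectors `N i` turn clockwise, a linear combination whose ratios to the non-negative
coefficients `m i` decrease lies to the left of the combination with coefficients `m i`. -/
theorem det2_sum_mul_nonpos {ι : Type*} [Fintype ι] [LinearOrder ι] {q m : ι → ℝ} {N : ι → Plane}
    (hq : Antitone q) (hm : ∀ i, 0 ≤ m i) (hN : ∀ i j, i < j → det2 (N i) (N j) ≤ 0) :
    det2 (∑ i, (q i * m i) • N i) (∑ j, m j • N j) ≤ 0 := by
  have e1 : det2 (∑ i, (q i * m i) • N i) (∑ j, m j • N j)
      = ∑ i, ∑ j, q i * (m i * m j * det2 (N i) (N j)) := by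
    rw [det2_sum_left]
    refine Finset.sum_congr rfl fun i _ => ?_
    rw [det2_sum_right]
    refine Finset.sum_congr rfl fun j _ => ?_
    rw [det2_smul_left, det2_smul_right]; ring
  have e2 : det2 (∑ i, (q i * m i) • N i) (∑ j, m j • N j)
      = ∑ i, ∑ j, -(q j * (m i * m j * det2 (N i) (N j))) := by
    rw [e1, Finset.sum_comm]
    refine Finset.sum_congr rfl fun i _ => Finset.sum_congr rfl fun j _ => ?_
    rw [det2_swap (N j)]; ring
  have e3 : det2 (∑ i, (q i * m i) • N i) (∑ j, m j • N j)
      + det2 (∑ i, (q i * m i) • N i) (∑ j, m j • N j) ≤ 0 := by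
    nth_rewrite 1 [e1]
    rw [e2, ← Finset.sum_add_distrib]
    refine Finset.sum_nonpos fun i _ => ?_
    rw [← Finset.sum_add_distrib]
    refine Finset.sum_nonpos fun j _ => ?_
    have hmm := mul_nonneg (hm i) (hm j)
    have : (q i - q j) * det2 (N i) (N j) ≤ 0 := by
      rcases lt_trichotomy i j with h | h | h
      · exact mul_nonpos_of_nonneg_of_nonpos (sub_nonneg.2 (hq h.le)) (hN i j h)
      · rw [h, sub_self, zero_mul]
      · refine mul_nonpos_of_nonpos_of_nonneg (sub_nonpos.2 (hq h.le)) ?_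
        rw [det2_swap]; linarith [hN j i h]
    have := mul_nonpos_of_nonneg_of_nonpos hmm this
    linarith
  linarith

/-! ### The gradient of `ξ` -/

section gradient

variable {n : ℕ} (Q : PolygonData n) (ν : Plane) (a : Fin (n + 1) → ℝ)

/-- The distance of the point `h = (H, r)` from the point `(-a_i, 0)` of the axis. -/
noncomputable def rho (h : ℝ × ℝ) (i : Fin (n + 1)) : ℝ := Real.sqrt ((h.1 + a i) ^ 2 + h.2 ^ 2)

/-- The coefficients `(1 - (H + a_i) / ρ_i) / 2` of `r ∂ξ/∂r`. -/
noncomputable def radialCoeff (h : ℝ × ℝ) (i : Fin (n + 1)) : ℝ := (1 - (h.1 + a i) / rho a h i) / 2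

/-- The vector `∂ξ/∂H`, in closed form. -/
noncomputable def gradH (h : ℝ × ℝ) : Plane :=
  ν + (1 / 2 : ℝ) • ∑ i : Fin (n + 1), (1 / rho a h i) • (Q.normal i.succ - Q.normal i.castSucc)

/-- The vector `r ∂ξ/∂r`, in closed form. -/
noncomputable def radialGradR (h : ℝ × ℝ) : Plane :=
  Q.normal 0 + ∑ i : Fin (n + 1), radialCoeff a h i • (Q.normal i.succ - Q.normal i.castSucc)

variable {a}

theorem rho_sq (h : ℝ × ℝ) (i : Fin (n + 1)) : rho a h i ^ 2 = (h.1 + a i) ^ 2 + h.2 ^ 2 :=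
  Real.sq_sqrt (by positivity)

theorem rho_nonneg (h : ℝ × ℝ) (i : Fin (n + 1)) : 0 ≤ rho a h i := Real.sqrt_nonneg _

theorem abs_le_rho (h : ℝ × ℝ) (i : Fin (n + 1)) : |h.1 + a i| ≤ rho a h i :=
  Real.abs_le_sqrt (by nlinarith [sq_nonneg h.2])

theorem rho_pos {h : ℝ × ℝ} (hr : 0 < h.2) (i : Fin (n + 1)) : 0 < rho a h i :=
  Real.sqrt_pos.2 (by positivity)

theorem le_rho (h : ℝ × ℝ) (i : Fin (n + 1)) : h.2 ≤ rho a h i :=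
  Real.le_sqrt_of_sq_le (by nlinarith [sq_nonneg (h.1 + a i)])

theorem abs_lt_rho {h : ℝ × ℝ} (hr : 0 < h.2) (i : Fin (n + 1)) : |h.1 + a i| < rho a h i :=
  abs_lt_of_sq_lt_sq (by rw [rho_sq]; nlinarith) (rho_nonneg h i)

theorem hasFDerivAt_rho {h : ℝ × ℝ} (hr : 0 < h.2) (i : Fin (n + 1)) :
    HasFDerivAt (fun q => rho a q i) (((h.1 + a i) / rho a h i) • ContinuousLinearMap.fst ℝ ℝ ℝ
      + (h.2 / rho a h i) • ContinuousLinearMap.snd ℝ ℝ ℝ) h := by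
  have h1 : HasFDerivAt (fun q : ℝ × ℝ => q.1 + a i) (ContinuousLinearMap.fst ℝ ℝ ℝ) h :=
    hasFDerivAt_fst.add_const _
  have h2 : HasFDerivAt (fun q : ℝ × ℝ => q.2) (ContinuousLinearMap.snd ℝ ℝ ℝ) h := hasFDerivAt_snd
  have h3 := ((h1.pow 2).add (h2.pow 2)).sqrt
    (show (h.1 + a i) ^ 2 + h.2 ^ 2 ≠ 0 by positivity)
  have hρ : Real.sqrt ((h.1 + a i) ^ 2 + h.2 ^ 2) ≠ 0 := (rho_pos (a := a) hr i).ne'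
  refine h3.congr_fderiv ?_
  ext <;> simp [rho] <;> field_simp

theorem hasFDerivAt_log_add_rho {h : ℝ × ℝ} (hr : 0 < h.2) (i : Fin (n + 1)) :
    HasFDerivAt (fun q : ℝ × ℝ => Real.log (q.1 + a i + rho a q i))
      ((1 / rho a h i) • ContinuousLinearMap.fst ℝ ℝ ℝ
      + (2 * radialCoeff a h i / h.2) • ContinuousLinearMap.snd ℝ ℝ ℝ) h := by
  have h1 : HasFDerivAt (fun q : ℝ × ℝ => q.1 + a i) (ContinuousLinearMap.fst ℝ ℝ ℝ) h :=
    hasFDerivAt_fst.add_const _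
  have hpos : 0 < h.1 + a i + rho a h i := by
    linarith [neg_abs_le (h.1 + a i), abs_lt_rho (a := a) hr i]
  have h2 := (h1.add (hasFDerivAt_rho (a := a) hr i)).log hpos.ne'
  have hρ := rho_pos (a := a) hr i
  have hsq := rho_sq (a := a) h i
  refine h2.congr_fderiv ?_
  ext
  · simp
    field_simp
    ring
  · simp [radialCoeff]
    field_simp
    linear_combination -hsq

theorem hasFDerivAt_xi {h : ℝ × ℝ} (hr : 0 < h.2) (k : Fin 2) :
    HasFDerivAt (fun q => xi Q ν a q k) (gradH Q ν a h k • ContinuousLinearMap.fst ℝ ℝ ℝ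
      + (radialGradR Q a h k / h.2) • ContinuousLinearMap.snd ℝ ℝ ℝ) h := by
  have e : (fun q => xi Q ν a q k) = fun q : ℝ × ℝ => Real.log q.2 * Q.normal 0 k
      + (1 / 2 : ℝ) * ∑ i : Fin (n + 1), Real.log (q.1 + a i + rho a q i) *
          (Q.normal i.succ k - Q.normal i.castSucc k) + q.1 * ν k := by
    funext q
    simp [xi, rho, Finset.sum_apply]
  rw [e]
  have h1 : HasFDerivAt (fun q : ℝ × ℝ => q.1) (ContinuousLinearMap.fst ℝ ℝ ℝ) h := hasFDerivAt_fst
  have h2 : HasFDerivAt (fun q : ℝ × ℝ => q.2) (ContinuousLinearMap.snd ℝ ℝ ℝ) h := hasFDerivAt_snd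
  have h3 := (((h2.log hr.ne').mul_const (Q.normal 0 k)).add
    ((HasFDerivAt.fun_sum (u := Finset.univ) fun i _ =>
      (hasFDerivAt_log_add_rho (a := a) hr i).mul_const
        (Q.normal i.succ k - Q.normal i.castSucc k)).const_mul (1 / 2 : ℝ))).add (h1.mul_const (ν k))
  refine h3.congr_fderiv ?_
  ext
  · simp [gradH, Finset.sum_apply, Finset.mul_sum]
    rw [add_comm]
    congr 1
    exact Finset.sum_congr rfl fun i _ => by ring
  · simp [radialGradR, Finset.sum_apply, Finset.mul_sum, add_div, Finset.sum_div]
    rw [div_eq_mul_inv (Q.normal 0 k)]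
    congr 1
    exact Finset.sum_congr rfl fun i _ => by ring

theorem xiH_eq {h : ℝ × ℝ} (hr : 0 < h.2) (k : Fin 2) : xiH Q ν a k h = gradH Q ν a h k := by
  have h1 : HasDerivAt (fun H : ℝ => (H, h.2)) ((1 : ℝ), (0 : ℝ)) h.1 :=
    (hasDerivAt_id _).prodMk (hasDerivAt_const _ _)
  have := (hasFDerivAt_xi Q ν (a := a) (h := (h.1, h.2)) hr k).comp_hasDerivAt h.1 h1
  simpa [xiH, Function.comp_def] using this.deriv

theorem xiR_eq {h : ℝ × ℝ} (hr : 0 < h.2) (k : Fin 2) :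
    xiR Q ν a k h = radialGradR Q a h k / h.2 := by
  have h1 : HasDerivAt (fun r : ℝ => (h.1, r)) ((0 : ℝ), (1 : ℝ)) h.2 :=
    (hasDerivAt_const _ _).prodMk (hasDerivAt_id _)
  have := (hasFDerivAt_xi Q ν (a := a) (h := (h.1, h.2)) hr k).comp_hasDerivAt h.2 h1
  simpa [xiR, Function.comp_def] using this.deriv

/-! ### Bounds for the gradient of `ξ` -/

/-- The weight of the `k`-th normal in the convex combination `r ∂ξ/∂r`. -/
noncomputable def edgeWeight (a : Fin (n + 1) → ℝ) (h : ℝ × ℝ) (k : Fin (n + 2)) : ℝ :=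
  padEnds 1 (radialCoeff a h) 0 k.castSucc - padEnds 1 (radialCoeff a h) 0 k.succ

theorem radialGradR_eq_sum (h : ℝ × ℝ) :
    radialGradR Q a h = ∑ k, edgeWeight a h k • Q.normal k := by
  have := sum_padEnds_sub_smul 1 (radialCoeff a h) 0 Q.normal
  rw [← neg_inj, ← Finset.sum_neg_distrib]
  simp only [edgeWeight, ← neg_smul, neg_sub]
  rw [this, radialGradR]
  simp only [zero_smul, one_smul]
  abel

theorem sum_edgeWeight (h : ℝ × ℝ) : ∑ k, edgeWeight a h k = 1 := by
  have := sum_padEnds_sub_smul 1 (radialCoeff a h) 0 (fun _ => (1 : ℝ))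
  rw [← neg_inj, ← Finset.sum_neg_distrib]
  simpa [edgeWeight] using this

/-- The cosine `(H + a_i) / ρ_i` increases with `a_i`. -/
theorem radialCoeff_strictAnti (ha : StrictMono a) {h : ℝ × ℝ} (hr : 0 < h.2) :
    StrictAnti (radialCoeff a h) := by
  intro i j hij
  have hi := rho_pos (a := a) hr i
  have hj := rho_pos (a := a) hr j
  have haij := ha hij
  have : (h.1 + a i) / rho a h i < (h.1 + a j) / rho a h j := by
    have hd : ∀ c : ℝ, HasDerivAt (fun c => c / Real.sqrt (c ^ 2 + h.2 ^ 2))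
        (h.2 ^ 2 / Real.sqrt (c ^ 2 + h.2 ^ 2) ^ 3) c := by
      intro c
      have hp : 0 < c ^ 2 + h.2 ^ 2 := by positivity
      have hs := Real.sqrt_pos.2 hp
      have h2 := Real.sq_sqrt hp.le
      have h1 : HasDerivAt (fun c : ℝ => c ^ 2 + h.2 ^ 2) (2 * c) c := by
        simpa using (hasDerivAt_pow 2 c).add_const (h.2 ^ 2)
      have h3 := (hasDerivAt_id c).div (h1.sqrt hp.ne') hs.ne'
      refine h3.congr_deriv ?_
      simp only [id]
      field_simp
      linear_combination h2
    have hmono : StrictMono fun c : ℝ => c / Real.sqrt (c ^ 2 + h.2 ^ 2) :=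
      strictMono_of_hasDerivAt_pos hd fun c => by positivity
    exact hmono (by linarith)
  simp only [radialCoeff]
  linarith

theorem radialCoeff_pos {h : ℝ × ℝ} (hr : 0 < h.2) (i : Fin (n + 1)) : 0 < radialCoeff a h i := by
  have hi := rho_pos (a := a) hr i
  have : (h.1 + a i) / rho a h i < 1 := by
    rw [div_lt_one hi]
    exact (le_abs_self _).trans_lt (abs_lt_rho hr i)
  simp only [radialCoeff]; linarith

theorem radialCoeff_lt_one {h : ℝ × ℝ} (hr : 0 < h.2) (i : Fin (n + 1)) :
    radialCoeff a h i < 1 := by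
  have hi := rho_pos (a := a) hr i
  have : -1 < (h.1 + a i) / rho a h i := by
    rw [lt_div_iff₀ hi]
    linarith [neg_abs_le (h.1 + a i), abs_lt_rho (a := a) hr i]
  simp only [radialCoeff]; linarith

theorem edgeWeight_pos (ha : StrictMono a) {h : ℝ × ℝ} (hr : 0 < h.2) (k : Fin (n + 2)) :
    0 < edgeWeight a h k := by
  refine forall_fin_of_first_of_last_of_mid (P := fun k => 0 < edgeWeight a h k)
    ?_ ?_ (fun i => ?_) k
  · rw [edgeWeight, padEnds_castSucc_zero, padEnds_succ_zero]
    linarith [radialCoeff_lt_one (a := a) hr 0]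
  · rw [edgeWeight, padEnds_castSucc_last, padEnds_succ_last]
    linarith [radialCoeff_pos (a := a) hr (Fin.last n)]
  · rw [edgeWeight, padEnds_mid_castSucc, padEnds_mid_succ]
    linarith [radialCoeff_strictAnti ha hr (Fin.castSucc_lt_succ (i := i))]

theorem det2_radialGradR_le {δ : ℝ} (ha : StrictMono a) {h : ℝ × ℝ} (hr : 0 < h.2)
    (hδ : ∀ k, δ ≤ det2 ν (Q.normal k)) : δ ≤ det2 ν (radialGradR Q a h) := by
  rw [radialGradR_eq_sum, det2_sum_right]
  calc δ = ∑ k, edgeWeight a h k * δ := by rw [← Finset.sum_mul, sum_edgeWeight, one_mul]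
    _ ≤ _ := Finset.sum_le_sum fun k _ => by
      rw [det2_smul_right]
      exact mul_le_mul_of_nonneg_left (hδ k) (edgeWeight_pos ha hr k).le

/-- The slopes of the chords joining successive points `((H + a_i) / ρ_i, r / ρ_i)` of the unit
half-circle, from `(-1, 0)` to `(1, 0)`. -/
noncomputable def chordSlope (a : Fin (n + 1) → ℝ) (h : ℝ × ℝ) (k : Fin (n + 2)) : ℝ :=
  (padEnds 0 (fun i => h.2 / rho a h i) 0 k.succ - padEnds 0 (fun i => h.2 / rho a h i) 0 k.castSucc)
    / ((1 - 2 * padEnds 1 (radialCoeff a h) 0 k.succ)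
      - (1 - 2 * padEnds 1 (radialCoeff a h) 0 k.castSucc))

theorem chordSlope_antitone (ha : StrictMono a) {h : ℝ × ℝ} (hr : 0 < h.2) :
    Antitone (chordSlope a h) := by
  have hcircle : ∀ k : Fin (n + 3), (1 - 2 * padEnds 1 (radialCoeff a h) 0 k) ^ 2
      + padEnds 0 (fun i => h.2 / rho a h i) 0 k ^ 2 = 1 := by
    refine forall_fin_of_first_of_last_of_mid ?_ ?_ fun i => ?_
    · rw [← Fin.castSucc_zero, padEnds_castSucc_zero, padEnds_castSucc_zero]; norm_num
    · rw [← Fin.succ_last, padEnds_succ_last, padEnds_succ_last]; norm_num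
    · rw [padEnds_castSucc_succ, padEnds_castSucc_succ, radialCoeff]
      have hi := rho_pos (a := a) hr i
      have := rho_sq (a := a) h i
      field_simp
      linear_combination -this
  have hlt : ∀ k : Fin (n + 2), 1 - 2 * padEnds 1 (radialCoeff a h) 0 k.castSucc
      < 1 - 2 * padEnds 1 (radialCoeff a h) 0 k.succ := by
    intro k
    have := edgeWeight_pos ha hr k
    rw [edgeWeight] at this
    linarith
  rw [Fin.antitone_iff_succ_le]
  intro i
  have h2 := hlt i.succ
  rw [← Fin.succ_castSucc] at h2
  simp only [chordSlope]
  rw [← Fin.succ_castSucc]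
  refine chord_slope_le (hcircle _) (hcircle _) (hcircle _) ?_ (hlt _) h2
  rw [padEnds_castSucc_succ]
  exact div_nonneg hr.le (rho_nonneg _ _)

theorem gradH_eq_sum (ha : StrictMono a) {h : ℝ × ℝ} (hr : 0 < h.2) :
    gradH Q ν a h
      = ν + (-(1 / h.2)) • ∑ k, (chordSlope a h k * edgeWeight a h k) • Q.normal k := by
  have := sum_padEnds_sub_smul 0 (fun i => h.2 / rho a h i) 0 Q.normal
  have e : ∀ k, chordSlope a h k * edgeWeight a h k
      = (1 / 2 : ℝ) * (padEnds 0 (fun i => h.2 / rho a h i) 0 k.succ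
        - padEnds 0 (fun i => h.2 / rho a h i) 0 k.castSucc) := by
    intro k
    have hk := edgeWeight_pos ha hr k
    have : chordSlope a h k = (padEnds 0 (fun i => h.2 / rho a h i) 0 k.succ
        - padEnds 0 (fun i => h.2 / rho a h i) 0 k.castSucc) / (2 * edgeWeight a h k) := by
      rw [chordSlope, edgeWeight]; congr 1; ring
    rw [this]
    field_simp
  simp only [e, mul_smul, ← Finset.smul_sum]
  rw [this, gradH]
  congr 1
  simp only [zero_smul, sub_zero, zero_sub, smul_neg, neg_smul, neg_neg]
  rw [smul_comm, Finset.smul_sum (r := 1 / h.2)]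
  congr 1
  refine Finset.sum_congr rfl fun i _ => ?_
  rw [smul_smul]
  congr 1
  have := hr.ne'
  field_simp

/-- The Jacobian of `ξ` is bounded below by its leading term `det(ν, r ∂ξ/∂r)`. -/
theorem det2_le_det2_gradH (ha : StrictMono a)
    (hN : ∀ i j, i < j → det2 (Q.normal i) (Q.normal j) ≤ 0) {h : ℝ × ℝ} (hr : 0 < h.2) :
    det2 ν (radialGradR Q a h) ≤ det2 (gradH Q ν a h) (radialGradR Q a h) := by
  rw [gradH_eq_sum Q ν ha hr, det2_add_left, det2_smul_left]
  have := det2_sum_mul_nonpos (chordSlope_antitone ha hr)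
    (fun k => (edgeWeight_pos ha hr k).le) hN
  rw [← radialGradR_eq_sum] at this
  have h1 : 0 ≤ 1 / h.2 := by positivity
  nlinarith [mul_nonpos_of_nonneg_of_nonpos h1 this]

/-- The sum `∑ |det(w, ν_{i+1} - ν_i)|`. -/
noncomputable def totalTurn (w : Plane) : ℝ :=
  ∑ i : Fin (n + 1), |det2 w (Q.normal i.succ - Q.normal i.castSucc)|

theorem totalTurn_nonneg (w : Plane) : 0 ≤ totalTurn Q w :=
  Finset.sum_nonneg fun _ _ => abs_nonneg _

theorem abs_det2_sum_le (w : Plane) {c : Fin (n + 1) → ℝ} {K : ℝ} (hc : ∀ i, |c i| ≤ K) :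
    |det2 w (∑ i : Fin (n + 1), c i • (Q.normal i.succ - Q.normal i.castSucc))|
      ≤ K * totalTurn Q w := by
  rw [det2_sum_right, totalTurn, Finset.mul_sum]
  refine (Finset.abs_sum_le_sum_abs _ _).trans (Finset.sum_le_sum fun i _ => ?_)
  rw [det2_smul_right, abs_mul]
  exact mul_le_mul_of_nonneg_right (hc i) (abs_nonneg _)

theorem abs_mul_det2_gradH_sub_le (w : Plane) {h : ℝ × ℝ} (hr : 0 < h.2) :
    |h.2 * (det2 w (gradH Q ν a h) - det2 w ν)| ≤ totalTurn Q w := by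
  have e : h.2 * (det2 w (gradH Q ν a h) - det2 w ν) = det2 w (∑ i : Fin (n + 1),
      (h.2 / 2 * (1 / rho a h i)) • (Q.normal i.succ - Q.normal i.castSucc)) := by
    simp only [mul_smul, ← Finset.smul_sum]
    rw [gradH, det2_add_right, det2_smul_right, det2_smul_right]; ring
  rw [e]
  have := abs_det2_sum_le Q w (K := 1) (c := fun i => h.2 / 2 * (1 / rho a h i)) fun i => by
    have hi := rho_pos (a := a) hr i
    rw [abs_of_nonneg (by positivity)]
    have := le_rho (a := a) h i
    rw [mul_one_div, div_le_one hi]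
    linarith
  rwa [one_mul] at this

theorem abs_det2_radialGradR_le (w : Plane) {h : ℝ × ℝ} (hr : 0 < h.2) :
    |det2 w (radialGradR Q a h)| ≤ |det2 w (Q.normal 0)| + totalTurn Q w := by
  rw [radialGradR, det2_add_right]
  refine (abs_add_le _ _).trans (add_le_add_right ?_ _)
  have := abs_det2_sum_le Q w (K := 1) (c := radialCoeff a h) fun i => by
    rw [abs_of_pos (radialCoeff_pos hr i)]
    exact (radialCoeff_lt_one hr i).le
  rwa [one_mul] at this

theorem det2_gradH_radialGradR_le :
    ∃ K, ∀ h : ℝ × ℝ, 1 ≤ h.2 → det2 (gradH Q ν a h) (radialGradR Q a h) ≤ K := by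
  -- split `∂ξ/∂H` into its two coordinates, each of which is bounded for `r ≥ 1`
  have hb : ∀ w : Plane, ∀ h : ℝ × ℝ, 1 ≤ h.2 →
      |det2 w (gradH Q ν a h)| ≤ |det2 w ν| + totalTurn Q w := by
    intro w h hr
    have h1 := abs_mul_det2_gradH_sub_le Q ν (a := a) w (lt_of_lt_of_le one_pos hr)
    rw [abs_mul, abs_of_pos (lt_of_lt_of_le one_pos hr)] at h1
    have h2 : |det2 w (gradH Q ν a h) - det2 w ν| ≤ totalTurn Q w :=
      (le_mul_of_one_le_left (abs_nonneg _) hr).trans h1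
    have h3 := abs_sub_abs_le_abs_sub (det2 w (gradH Q ν a h)) (det2 w ν)
    linarith
  set e₀ : Plane := ![1, 0]
  set e₁ : Plane := ![0, 1]
  refine ⟨(|det2 e₁ ν| + totalTurn Q e₁) * (|det2 e₀ (Q.normal 0)| + totalTurn Q e₀)
    + (|det2 e₀ ν| + totalTurn Q e₀) * (|det2 e₁ (Q.normal 0)| + totalTurn Q e₁), fun h hr => ?_⟩
  have hr0 : 0 < h.2 := lt_of_lt_of_le one_pos hr
  have e : det2 (gradH Q ν a h) (radialGradR Q a h)
      = -(det2 e₁ (gradH Q ν a h) * det2 e₀ (radialGradR Q a h))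
        + det2 e₀ (gradH Q ν a h) * det2 e₁ (radialGradR Q a h) := by
    simp only [det2, e₀, e₁, Matrix.cons_val_zero, Matrix.cons_val_one]; ring
  rw [e]
  refine add_le_add ((neg_le_abs _).trans ?_) ((le_abs_self _).trans ?_)
  · rw [abs_mul]
    exact mul_le_mul (hb _ h hr) (abs_det2_radialGradR_le Q _ hr0) (abs_nonneg _)
      (add_nonneg (abs_nonneg _) (totalTurn_nonneg Q _))
  · rw [abs_mul]
    exact mul_le_mul (hb _ h hr) (abs_det2_radialGradR_le Q _ hr0) (abs_nonneg _)
      (add_nonneg (abs_nonneg _) (totalTurn_nonneg Q _))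

end gradient

/-! ### The action coordinates in closed form -/

section actionMap

variable {n : ℕ} (Q : PolygonData n) (ν : Plane) (a : Fin (n + 1) → ℝ)

/-- The functions `(H + a_i - ρ_i) / 2`, conjugate to the logarithms occurring in `ξ`. -/
noncomputable def conjLog (h : ℝ × ℝ) (i : Fin (n + 1)) : ℝ := (h.1 + a i - rho a h i) / 2

/-- The function conjugate to `ξ`: up to additive constants, `⟨x, w⟩ = det(w, xiConj)`. -/
noncomputable def xiConj (h : ℝ × ℝ) : Plane :=
  h.1 • Q.normal 0 + ∑ i : Fin (n + 1), conjLog a h i • (Q.normal i.succ - Q.normal i.castSucc)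
    - (h.2 ^ 2 / 2) • ν

variable {a}

theorem hasFDerivAt_det2_xiConj (w : Plane) {h : ℝ × ℝ} (hr : 0 < h.2) :
    HasFDerivAt (fun q => det2 w (xiConj Q ν a q))
      (det2 w (radialGradR Q a h) • ContinuousLinearMap.fst ℝ ℝ ℝ
        - (h.2 * det2 w (gradH Q ν a h)) • ContinuousLinearMap.snd ℝ ℝ ℝ) h := by
  have e : (fun q => det2 w (xiConj Q ν a q)) = fun q : ℝ × ℝ => q.1 * det2 w (Q.normal 0)
      + ∑ i : Fin (n + 1), ((q.1 + a i - rho a q i) / 2) *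
          det2 w (Q.normal i.succ - Q.normal i.castSucc) - (q.2 ^ 2 / 2) * det2 w ν := by
    funext q
    simp only [xiConj, conjLog, det2_sub_right w _ (_ • ν), det2_add_right, det2_sum_right,
      det2_smul_right]
  rw [e]
  have h1 : HasFDerivAt (fun q : ℝ × ℝ => q.1) (ContinuousLinearMap.fst ℝ ℝ ℝ) h := hasFDerivAt_fst
  have h2 : HasFDerivAt (fun q : ℝ × ℝ => q.2) (ContinuousLinearMap.snd ℝ ℝ ℝ) h := hasFDerivAt_snd
  have h3 := ((h1.mul_const (det2 w (Q.normal 0))).add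
    (HasFDerivAt.fun_sum (u := Finset.univ) fun i _ =>
      (((h1.add_const (a i)).sub (hasFDerivAt_rho (a := a) hr i)).mul_const (1 / 2)).mul_const
        (det2 w (Q.normal i.succ - Q.normal i.castSucc)))).sub
    (((h2.pow 2).mul_const (1 / 2)).mul_const (det2 w ν))
  refine (h3.congr_of_eventuallyEq (Filter.Eventually.of_forall fun q => ?_)).congr_fderiv ?_
  · simp only [Pi.add_apply, Pi.sub_apply, mul_one_div]
  · ext
    · simp only [gradH, radialGradR, radialCoeff, det2_add_right, det2_sum_right, det2_smul_right]
      simp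
      exact Finset.sum_congr rfl fun i _ => by ring
    · simp only [gradH, radialGradR, radialCoeff, det2_add_right, det2_sum_right, det2_smul_right]
      simp [mul_add, Finset.mul_sum]
      have e1 : ∑ i : Fin (n + 1), det2 w (Q.normal i.succ - Q.normal i.castSucc)
            * (2⁻¹ * (h.2 / rho a h i))
          = ∑ i : Fin (n + 1), h.2 * (2⁻¹ * ((rho a h i)⁻¹
            * det2 w (Q.normal i.succ - Q.normal i.castSucc))) :=
        Finset.sum_congr rfl fun i _ => by ring
      linarith

variable {Q ν} {x : ℝ × ℝ → Plane}

theorem IsActionMap.hasFDerivAt_dotProduct (hx : IsActionMap Q ν a x) (w : Plane) {h : ℝ × ℝ}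
    (hr : 0 < h.2) :
    HasFDerivAt (fun q => x q ⬝ᵥ w)
      (det2 w (radialGradR Q a h) • ContinuousLinearMap.fst ℝ ℝ ℝ
        - (h.2 * det2 w (gradH Q ν a h)) • ContinuousLinearMap.snd ℝ ℝ ℝ) h := by
  have h0 := (hx.primitive_fst h hr).mul_const (w 0)
  have h1 := (hx.primitive_snd h hr).mul_const (w 1)
  have e : (fun q => x q ⬝ᵥ w) = fun q => x q 0 * w 0 + x q 1 * w 1 := by
    funext q; simp [dotProduct, Fin.sum_univ_two]
  rw [e]
  refine (h0.add h1).congr_fderiv ?_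
  have hr' := hr.ne'
  ext
  · simp [xiR_eq Q ν hr, xiH_eq Q ν hr, det2]
    field_simp
    ring
  · simp [xiR_eq Q ν hr, xiH_eq Q ν hr, det2]
    ring

theorem continuous_rho (i : Fin (n + 1)) : Continuous fun q => rho a q i := by
  unfold rho; fun_prop

theorem continuous_xiConj : Continuous (xiConj Q ν a) := by
  have := fun i => continuous_rho (a := a) i
  unfold xiConj conjLog
  fun_prop

theorem IsActionMap.sub_dotProduct_eq (hx : IsActionMap Q ν a x) (w : Plane) {h h' : ℝ × ℝ}
    (hr : 0 ≤ h.2) (hr' : 0 ≤ h'.2) :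
    (x h - x h') ⬝ᵥ w = det2 w (xiConj Q ν a h - xiConj Q ν a h') := by
  have hconv : Convex ℝ {q : ℝ × ℝ | 0 < q.2} := by
    intro p hp q hq s t hs ht hst
    simp only [Set.mem_ofPred_eq, Prod.snd_add, Prod.smul_snd, smul_eq_mul] at *
    rcases hs.eq_or_lt with rfl | hs
    · have : t = 1 := by linarith
      subst this; linarith
    · exact add_pos_of_pos_of_nonneg (mul_pos hs hp) (mul_nonneg ht hq.le)
  have hopen : IsOpen {q : ℝ × ℝ | 0 < q.2} := isOpen_lt continuous_const continuous_snd
  let f : ℝ × ℝ → ℝ := fun q => x q ⬝ᵥ w - det2 w (xiConj Q ν a q)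
  have hf : ∀ q ∈ {q : ℝ × ℝ | 0 < q.2}, HasFDerivAt f 0 q := fun q hq =>
    ((hx.hasFDerivAt_dotProduct w hq).sub (hasFDerivAt_det2_xiConj Q ν w hq)).congr_fderiv
      (sub_self _)
  obtain ⟨c, hc⟩ := hopen.exists_is_const_of_fderiv_eq_zero hconv.isPreconnected
    (fun q hq => (hf q hq).differentiableAt.differentiableWithinAt) fun q hq => (hf q hq).fderiv
  have hcl : {q : ℝ × ℝ | 0 ≤ q.2} ⊆ closure {q : ℝ × ℝ | 0 < q.2} := by
    rintro ⟨H, r⟩ hq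
    refine mem_closure_of_tendsto (f := fun t : ℝ => (H, r + t))
      (b := nhdsWithin 0 (Set.Ioi 0)) ?_ ?_
    · have : Continuous fun t : ℝ => (H, r + t) := by fun_prop
      have := this.tendsto 0
      rw [add_zero] at this
      exact this.mono_left nhdsWithin_le_nhds
    · filter_upwards [self_mem_nhdsWithin] with t ht
      exact add_pos_of_nonneg_of_pos hq ht
  have hcont : ContinuousOn f {q : ℝ × ℝ | 0 ≤ q.2} := by
    have h1 := hx.continuousOn
    have h2 := continuous_xiConj (Q := Q) (ν := ν) (a := a)
    have h3 : Continuous fun y : Plane => y ⬝ᵥ w := by unfold dotProduct; fun_prop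
    have h4 : Continuous fun y : Plane => det2 w y := by unfold det2; fun_prop
    exact (h3.comp_continuousOn h1).sub (h4.comp h2).continuousOn
  have hEq : Set.EqOn f (fun _ => c) {q : ℝ × ℝ | 0 ≤ q.2} :=
    Set.EqOn.of_subset_closure (fun q hq => hc q hq) hcont continuousOn_const
      (fun q (hq : 0 < q.2) => hq.le) hcl
  have e1 : f h = c := hEq hr
  have e2 : f h' = c := hEq hr'
  simp only [f] at e1 e2
  rw [sub_dotProduct, det2_sub_right]
  linarith

/-! ### The half-plane is mapped onto the interior of the polygon -/

/-- `(H, 0)` lies in the interval of the axis which `x` maps to the `j`-th edge. -/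
structure OnEdgeInterval (a : Fin (n + 1) → ℝ) (j : Fin (n + 2)) (H : ℝ) : Prop where
  nonpos : ∀ i : Fin (n + 1), i.castSucc < j → H + a i ≤ 0
  nonneg : ∀ i : Fin (n + 1), j ≤ i.castSucc → 0 ≤ H + a i

theorem onEdgeInterval_castSucc (ha : StrictMono a) (i : Fin (n + 1)) :
    OnEdgeInterval a i.castSucc (-a i) where
  nonpos k hk := by linarith [ha.monotone (Fin.castSucc_lt_castSucc_iff.1 hk).le]
  nonneg k hk := by linarith [ha.monotone (Fin.castSucc_le_castSucc_iff.1 hk)]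

theorem onEdgeInterval_succ (ha : StrictMono a) (i : Fin (n + 1)) :
    OnEdgeInterval a i.succ (-a i) where
  nonpos k hk := by linarith [ha.monotone (Fin.castSucc_lt_succ_iff.1 hk)]
  nonneg k hk := by linarith [ha.monotone (Fin.succ_le_castSucc_iff.1 hk).le]

theorem exists_onEdgeInterval (ha : StrictMono a) (H : ℝ) : ∃ j, OnEdgeInterval a j H := by
  by_cases hall : ∀ i, 0 ≤ H + a i
  · exact ⟨0, fun i hi => absurd hi (Fin.not_lt_zero _), fun i _ => hall i⟩
  · push Not at hall
    obtain ⟨i₀, hi₀⟩ := hall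
    obtain ⟨i, hi, hmax⟩ := (Finset.univ.filter fun i => H + a i < 0).exists_max_image id
      ⟨i₀, by simpa using hi₀⟩
    have hi' : H + a i < 0 := by simpa using hi
    refine ⟨i.succ, fun k hk => ?_, fun k hk => ?_⟩
    · linarith [ha.monotone (Fin.castSucc_lt_succ_iff.1 hk)]
    · by_contra hneg
      have := hmax k (by simpa using hneg)
      exact absurd (Fin.succ_le_castSucc_iff.1 hk) (not_lt.2 this)

theorem IsActionMap.exists_vertex (hx : IsActionMap Q ν a x) (j : Fin (n + 2)) :
    ∃ H, OnEdgeInterval a j H ∧ Q.ell j (x (H, 0)) = 0 := by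
  refine Fin.lastCases (motive := fun j => ∃ H, OnEdgeInterval a j H ∧ Q.ell j (x (H, 0)) = 0)
    ?_ (fun i => ?_) j
  · exact ⟨-a (Fin.last n), onEdgeInterval_succ hx.strictMono (Fin.last n), (hx.vertex (Fin.last n)).2.2⟩
  · exact ⟨-a i, onEdgeInterval_castSucc hx.strictMono _, (hx.vertex i).1.2⟩

/-- The coefficient of the `k`-th normal in `xiConj`, after summation by parts. -/
noncomputable def conjCoeff (a : Fin (n + 1) → ℝ) (h : ℝ × ℝ) (k : Fin (n + 2)) : ℝ :=
  padEnds h.1 (conjLog a h) 0 k.castSucc - padEnds h.1 (conjLog a h) 0 k.succ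

theorem xiConj_eq_sum (h : ℝ × ℝ) :
    xiConj Q ν a h = ∑ k, conjCoeff a h k • Q.normal k - (h.2 ^ 2 / 2) • ν := by
  have := sum_padEnds_sub_smul h.1 (conjLog a h) 0 Q.normal
  have e : ∑ k, conjCoeff a h k • Q.normal k
      = -∑ k, (padEnds h.1 (conjLog a h) 0 k.succ - padEnds h.1 (conjLog a h) 0 k.castSucc)
        • Q.normal k := by
    rw [← Finset.sum_neg_distrib]
    simp only [conjCoeff, ← neg_smul, neg_sub]
  rw [e, this, xiConj, zero_smul]
  abel

theorem conjLog_nonpos (h : ℝ × ℝ) (i : Fin (n + 1)) : conjLog a h i ≤ 0 := by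
  have := (le_abs_self _).trans (abs_le_rho (a := a) h i)
  simp only [conjLog]; linarith

theorem conjLog_of_nonneg {H : ℝ} {i : Fin (n + 1)} (hi : 0 ≤ H + a i) :
    conjLog a (H, 0) i = 0 := by
  simp [conjLog, rho, Real.sqrt_sq hi]

theorem conjLog_of_nonpos {H : ℝ} {i : Fin (n + 1)} (hi : H + a i ≤ 0) :
    conjLog a (H, 0) i = H + a i := by
  simp only [conjLog, rho, ne_eq, OfNat.ofNat_ne_zero, not_false_eq_true, zero_pow, add_zero,
    Real.sqrt_sq_eq_abs, abs_of_nonpos hi]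
  ring

/-- The triangle inequality for the distances to two points of the axis. -/
theorem abs_rho_sub_rho_le (h : ℝ × ℝ) (i j : Fin (n + 1)) :
    |rho a h i - rho a h j| ≤ |a i - a j| := by
  have key : ∀ i j, rho a h i ≤ rho a h j + |a i - a j| := by
    intro i j
    have h1 := rho_nonneg (a := a) h j
    have h2 := abs_le_rho (a := a) h j
    refine Real.sqrt_le_iff.2 ⟨by positivity, ?_⟩
    have h3 := rho_sq (a := a) h j
    have h4 : (h.1 + a j) * (a i - a j) ≤ rho a h j * |a i - a j| := by
      refine (le_abs_self _).trans ?_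
      rw [abs_mul]
      exact mul_le_mul_of_nonneg_right h2 (abs_nonneg _)
    nlinarith [sq_abs (a i - a j)]
  have h1 := key i j
  have h2 := key j i
  rw [abs_sub_comm (a j)] at h2
  rw [abs_le]; constructor <;> linarith

theorem conjCoeff_le_of_lt {j k : Fin (n + 2)} {H : ℝ} (hH : OnEdgeInterval a j H)
    (ha : StrictMono a) (h : ℝ × ℝ) (hk : k < j) : conjCoeff a (H, 0) k ≤ conjCoeff a h k := by
  revert hk
  refine forall_fin_of_first_of_last_of_mid
    (P := fun k => k < j → conjCoeff a (H, 0) k ≤ conjCoeff a h k) ?_ ?_ (fun i => ?_) k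
  · intro hk
    simp only [conjCoeff, padEnds_castSucc_zero, padEnds_succ_zero]
    rw [conjLog_of_nonpos (hH.nonpos 0 hk), conjLog]
    linarith [neg_le_of_abs_le (abs_le_rho (a := a) h 0)]
  · exact fun hk => absurd hk (not_lt.2 (Fin.le_last _))
  · intro hk
    simp only [conjCoeff, padEnds_mid_castSucc, padEnds_mid_succ]
    have hlt : i.castSucc < i.succ := Fin.castSucc_lt_succ
    rw [conjLog_of_nonpos (hH.nonpos i.succ hk),
      conjLog_of_nonpos (hH.nonpos i.castSucc (lt_trans (Fin.castSucc_lt_castSucc_iff.2 hlt) hk)),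
      conjLog, conjLog]
    have h1 := abs_rho_sub_rho_le (a := a) h i.castSucc i.succ
    rw [abs_of_neg (sub_neg.2 (ha hlt))] at h1
    linarith [le_of_abs_le h1]

theorem conjCoeff_ge_of_gt {j k : Fin (n + 2)} {H : ℝ} (hH : OnEdgeInterval a j H)
    (ha : StrictMono a) (h : ℝ × ℝ) (hk : j < k) : conjCoeff a h k ≤ conjCoeff a (H, 0) k := by
  revert hk
  refine forall_fin_of_first_of_last_of_mid
    (P := fun k => j < k → conjCoeff a h k ≤ conjCoeff a (H, 0) k) ?_ ?_ (fun i => ?_) k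
  · exact fun hk => absurd hk (Fin.not_lt_zero _)
  · intro hk
    simp only [conjCoeff, padEnds_castSucc_last, padEnds_succ_last]
    rw [conjLog_of_nonneg (hH.nonneg (Fin.last n) (Fin.le_castSucc_iff.2 hk))]
    linarith [conjLog_nonpos (a := a) h (Fin.last n)]
  · intro hk
    simp only [conjCoeff, padEnds_mid_castSucc, padEnds_mid_succ]
    have hlt : i.castSucc < i.succ := Fin.castSucc_lt_succ
    have hj : j ≤ i.castSucc.castSucc := Fin.le_castSucc_iff.2 hk
    rw [conjLog_of_nonneg (hH.nonneg i.succ (hj.trans (Fin.castSucc_lt_castSucc_iff.2 hlt).le)),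
      conjLog_of_nonneg (hH.nonneg i.castSucc hj), conjLog, conjLog]
    have h1 := abs_rho_sub_rho_le (a := a) h i.castSucc i.succ
    rw [abs_of_neg (sub_neg.2 (ha hlt))] at h1
    linarith [neg_le_of_abs_le h1]

theorem IsActionMap.ell_eq (hx : IsActionMap Q ν a x) {j : Fin (n + 2)} {H : ℝ}
    (h0 : Q.ell j (x (H, 0)) = 0) {h : ℝ × ℝ} (hr : 0 ≤ h.2) :
    Q.ell j (x h) = ∑ k, (conjCoeff a h k - conjCoeff a (H, 0) k) * det2 (Q.normal j) (Q.normal k)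
      + h.2 ^ 2 / 2 * det2 ν (Q.normal j) := by
  have h1 := hx.sub_dotProduct_eq (Q.normal j) hr (h' := (H, 0)) le_rfl
  rw [← PolygonData.ell_sub_ell, h0, sub_zero] at h1
  rw [h1, xiConj_eq_sum, xiConj_eq_sum, det2_sub_right, det2_sub_right, det2_sub_right,
    det2_sum_right, det2_sum_right, det2_smul_right, det2_smul_right, det2_swap _ ν]
  simp only [det2_smul_right, sub_mul, Finset.sum_sub_distrib]
  ring

theorem conjCoeff_sub_mul_nonneg (ha : StrictMono a)
    (hN : ∀ i j, i < j → det2 (Q.normal i) (Q.normal j) ≤ 0) {j : Fin (n + 2)} {H : ℝ}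
    (hH : OnEdgeInterval a j H) (h : ℝ × ℝ) (k : Fin (n + 2)) :
    0 ≤ (conjCoeff a h k - conjCoeff a (H, 0) k) * det2 (Q.normal j) (Q.normal k) := by
  rcases lt_trichotomy k j with hk | rfl | hk
  · refine mul_nonneg (sub_nonneg.2 (conjCoeff_le_of_lt hH ha h hk)) ?_
    rw [det2_swap]; linarith [hN k j hk]
  · rw [det2_self, mul_zero]
  · exact mul_nonneg_of_nonpos_of_nonpos (sub_nonpos.2 (conjCoeff_ge_of_gt hH ha h hk)) (hN j k hk)

theorem IsActionMap.le_ell (hx : IsActionMap Q ν a x)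
    (hN : ∀ i j, i < j → det2 (Q.normal i) (Q.normal j) ≤ 0) (j : Fin (n + 2)) {h : ℝ × ℝ}
    (hr : 0 ≤ h.2) : h.2 ^ 2 / 2 * det2 ν (Q.normal j) ≤ Q.ell j (x h) := by
  obtain ⟨H, hH, h0⟩ := hx.exists_vertex j
  rw [hx.ell_eq h0 hr]
  exact le_add_of_nonneg_left
    (Finset.sum_nonneg fun k _ => conjCoeff_sub_mul_nonneg hx.strictMono hN hH h k)

/-- The axis `r = 0` is mapped to the boundary of the polygon. -/
theorem IsActionMap.exists_ell_eq_zero (hx : IsActionMap Q ν a x) (H : ℝ) :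
    ∃ j, Q.ell j (x (H, 0)) = 0 := by
  obtain ⟨j, hj⟩ := exists_onEdgeInterval hx.strictMono H
  obtain ⟨H', hH', h0⟩ := hx.exists_vertex j
  refine ⟨j, ?_⟩
  rw [hx.ell_eq h0 (h := (H, 0)) le_rfl]
  simp only [ne_eq, OfNat.ofNat_ne_zero, not_false_eq_true, zero_pow, zero_div, zero_mul, add_zero]
  refine Finset.sum_eq_zero fun k _ => ?_
  rcases lt_trichotomy k j with hk | rfl | hk
  · rw [le_antisymm (conjCoeff_le_of_lt hj hx.strictMono _ hk)
      (conjCoeff_le_of_lt hH' hx.strictMono _ hk), sub_self, zero_mul]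
  · rw [det2_self, mul_zero]
  · rw [le_antisymm (conjCoeff_ge_of_gt hj hx.strictMono _ hk)
      (conjCoeff_ge_of_gt hH' hx.strictMono _ hk), sub_self, zero_mul]

theorem IsActionMap.le_ell_last (hx : IsActionMap Q ν a x)
    (hN : ∀ i j, i < j → det2 (Q.normal i) (Q.normal j) ≤ 0)
    (hν : 0 ≤ det2 ν (Q.normal (Fin.last (n + 1)))) {h : ℝ × ℝ} (hr : 0 ≤ h.2) :
    (h.1 + a 0) * -det2 (Q.normal 0) (Q.normal (Fin.last (n + 1)))
      ≤ Q.ell (Fin.last (n + 1)) (x h) := by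
  obtain ⟨H, hH, h0⟩ := hx.exists_vertex (Fin.last (n + 1))
  have hlt : (0 : Fin (n + 2)) < Fin.last (n + 1) := Fin.last_pos
  rw [hx.ell_eq h0 hr]
  refine le_trans ?_ (le_add_of_nonneg_right (by positivity))
  refine le_trans ?_ (Finset.single_le_sum
    (fun k _ => conjCoeff_sub_mul_nonneg hx.strictMono hN hH h k) (Finset.mem_univ 0))
  rw [det2_swap (Q.normal (Fin.last (n + 1)))]
  refine mul_le_mul_of_nonneg_right ?_ (by linarith [hN _ _ hlt])
  simp only [conjCoeff, padEnds_castSucc_zero, padEnds_succ_zero]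
  rw [conjLog_of_nonpos (hH.nonpos 0 hlt), conjLog]
  linarith [le_of_abs_le (abs_le_rho (a := a) h 0)]

theorem IsActionMap.le_ell_zero (hx : IsActionMap Q ν a x)
    (hN : ∀ i j, i < j → det2 (Q.normal i) (Q.normal j) ≤ 0)
    (hν : 0 ≤ det2 ν (Q.normal 0)) {h : ℝ × ℝ} (hr : 0 ≤ h.2) :
    -(h.1 + a (Fin.last n)) * -det2 (Q.normal 0) (Q.normal (Fin.last (n + 1)))
      ≤ Q.ell 0 (x h) := by
  obtain ⟨H, hH, h0⟩ := hx.exists_vertex 0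
  have hlt : (0 : Fin (n + 2)) < Fin.last (n + 1) := Fin.last_pos
  rw [hx.ell_eq h0 hr]
  refine le_trans ?_ (le_add_of_nonneg_right (by positivity))
  refine le_trans ?_ (Finset.single_le_sum
    (fun k _ => conjCoeff_sub_mul_nonneg hx.strictMono hN hH h k)
    (Finset.mem_univ (Fin.last (n + 1))))
  rw [neg_mul_neg]
  refine mul_le_mul_of_nonpos_right ?_ (hN _ _ hlt)
  simp only [conjCoeff, padEnds_castSucc_last, padEnds_succ_last]
  rw [conjLog_of_nonneg (hH.nonneg (Fin.last n) (Fin.zero_le _)), conjLog]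
  linarith [neg_le_of_abs_le (abs_le_rho (a := a) h (Fin.last n))]

/-- The derivative of the action map at a point of the open half-plane. -/
noncomputable def actionDeriv (Q : PolygonData n) (ν : Plane) (a : Fin (n + 1) → ℝ) (h : ℝ × ℝ) :
    ℝ × ℝ →L[ℝ] Plane :=
  (ContinuousLinearMap.fst ℝ ℝ ℝ).smulRight ![radialGradR Q a h 1, -radialGradR Q a h 0]
    + (ContinuousLinearMap.snd ℝ ℝ ℝ).smulRight (h.2 • ![-gradH Q ν a h 1, gradH Q ν a h 0])

theorem IsActionMap.hasFDerivAt (hx : IsActionMap Q ν a x) {h : ℝ × ℝ} (hr : 0 < h.2) :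
    HasFDerivAt x (actionDeriv Q ν a h) h := by
  rw [hasFDerivAt_pi']
  have hr' := hr.ne'
  intro k
  fin_cases k
  · refine (hx.primitive_fst h hr).congr_fderiv ?_
    ext <;> simp [actionDeriv, xiR_eq Q ν hr, xiH_eq Q ν hr]
    field_simp
  · refine (hx.primitive_snd h hr).congr_fderiv ?_
    ext <;> simp [actionDeriv, xiR_eq Q ν hr, xiH_eq Q ν hr]
    field_simp

theorem continuousAt_actionDeriv {h : ℝ × ℝ} (hr : 0 < h.2) :
    ContinuousAt (actionDeriv Q ν a) h := by
  have hρ : ∀ i, rho a h i ≠ 0 := fun i => (rho_pos hr i).ne'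
  have hc : ∀ i, ContinuousAt (fun q => rho a q i) h := fun i => (continuous_rho i).continuousAt
  have hA : ContinuousAt (radialGradR Q a) h := by
    unfold radialGradR radialCoeff
    fun_prop (disch := exact hρ _)
  have hV : ContinuousAt (gradH Q ν a) h := by
    unfold gradH
    fun_prop (disch := exact hρ _)
  have hA0 := (continuous_apply (0 : Fin 2)).continuousAt.comp hA
  have hA1 := (continuous_apply (1 : Fin 2)).continuousAt.comp hA
  have hV0 := (continuous_apply (0 : Fin 2)).continuousAt.comp hV
  have hV1 := (continuous_apply (1 : Fin 2)).continuousAt.comp hV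
  have e1 : ContinuousAt (fun q => ![radialGradR Q a q 1, -radialGradR Q a q 0]) h := by
    rw [continuousAt_pi]; intro k; fin_cases k
    · exact hA1
    · exact hA0.neg
  have e2 : ContinuousAt (fun q : ℝ × ℝ => q.2 • ![-gradH Q ν a q 1, gradH Q ν a q 0]) h := by
    refine continuousAt_snd.smul ?_
    rw [continuousAt_pi]; intro k; fin_cases k
    · exact hV1.neg
    · exact hV0
  have e3 : ∀ L : ℝ × ℝ →L[ℝ] ℝ, Continuous fun v : Plane => L.smulRight v := fun L =>
    (ContinuousLinearMap.smulRightL ℝ (ℝ × ℝ) Plane L).continuous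
  exact ((e3 _).continuousAt.comp e1).add ((e3 _).continuousAt.comp e2)

theorem actionDeriv_surjective {h : ℝ × ℝ} (hr : 0 < h.2)
    (hdet : 0 < det2 (gradH Q ν a h) (radialGradR Q a h)) :
    Function.Surjective (actionDeriv Q ν a h) := by
  intro y
  refine ⟨((gradH Q ν a h 0 * y 0 + gradH Q ν a h 1 * y 1)
      / det2 (gradH Q ν a h) (radialGradR Q a h),
    (radialGradR Q a h 0 * y 0 + radialGradR Q a h 1 * y 1)
      / (h.2 * det2 (gradH Q ν a h) (radialGradR Q a h))), ?_⟩
  have hd := hdet.ne'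
  have hr' := hr.ne'
  ext k
  fin_cases k
  · simp [actionDeriv]
    field_simp
    simp only [det2]; ring
  · simp [actionDeriv]
    field_simp
    simp only [det2]; ring

theorem IsActionMap.image_eq (hQ : Q.IsStrictlyUnbounded) (hx : IsActionMap Q ν a x)
    (hν : ∀ j, 0 < det2 ν (Q.normal j)) :
    x '' {h | 0 < h.2} = interior Q.region := by
  have hN : ∀ i j, i < j → det2 (Q.normal i) (Q.normal j) ≤ 0 :=
    fun i j hij => (hQ.det2_neg_of_lt hν hij).le
  rw [hQ.interior_region]
  have hsub : x '' {h | 0 < h.2} ⊆ {y | ∀ j, 0 < Q.ell j y} := by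
    rintro _ ⟨h, hr, rfl⟩ j
    have hr : 0 < h.2 := hr
    exact lt_of_lt_of_le (mul_pos (by positivity) (hν j)) (hx.le_ell hN j hr.le)
  refine Set.Subset.antisymm hsub ?_
  have hopen : IsOpen (x '' {h | 0 < h.2}) := by
    rw [isOpen_iff_mem_nhds]
    rintro _ ⟨h, hr, rfl⟩
    have hUopen : IsOpen {q : ℝ × ℝ | 0 < q.2} := isOpen_lt continuous_const continuous_snd
    have hU : {q : ℝ × ℝ | 0 < q.2} ∈ nhds h := hUopen.mem_nhds hr
    have hstrict : HasStrictFDerivAt x (actionDeriv Q ν a h) h :=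
      hasStrictFDerivAt_of_hasFDerivAt_of_continuousAt
        (Filter.mem_of_superset hU fun q hq => hx.hasFDerivAt hq) (continuousAt_actionDeriv hr)
    have hdet : 0 < det2 (gradH Q ν a h) (radialGradR Q a h) := by
      refine lt_of_lt_of_le ?_ (det2_le_det2_gradH Q ν hx.strictMono hN hr)
      rw [radialGradR_eq_sum, det2_sum_right]
      refine Finset.sum_pos (fun k _ => ?_) Finset.univ_nonempty
      rw [det2_smul_right]
      exact mul_pos (edgeWeight_pos hx.strictMono hr k) (hν k)
    rw [← hstrict.map_nhds_eq_of_surj (LinearMap.range_eq_top.2 (actionDeriv_surjective hr hdet))]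
    exact Filter.image_mem_map hU
  have hconn : IsPreconnected {y | ∀ j, 0 < Q.ell j y} := by
    rw [← hQ.interior_region]
    exact PolygonData.convex_region.interior.isPreconnected
  refine hconn.subset_of_closure_inter_subset hopen ?_ ?_
  · have hm : x (0, 1) ∈ x '' {h | 0 < h.2} := ⟨(0, 1), one_pos (α := ℝ), rfl⟩
    exact ⟨_, hsub hm, hm⟩
  · -- properness: the points of the image near `y` come from a compact box
    rintro y ⟨hyc, hy⟩
    set D := -det2 (Q.normal 0) (Q.normal (Fin.last (n + 1))) with hD
    have hDpos : 0 < D := neg_pos.2 hQ.det2_first_last_neg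
    set e₀ := Q.ell 0 y + 1
    set e₁ := Q.ell (Fin.last (n + 1)) y + 1
    let O : Set Plane := {z | Q.ell 0 z < e₀} ∩ {z | Q.ell (Fin.last (n + 1)) z < e₁}
    have hO : IsOpen O := (isOpen_lt (PolygonData.continuous_ell _) continuous_const).inter
      (isOpen_lt (PolygonData.continuous_ell _) continuous_const)
    have hyO : y ∈ O := ⟨lt_add_one (Q.ell 0 y), lt_add_one (Q.ell (Fin.last (n + 1)) y)⟩
    let B : Set (ℝ × ℝ) := Set.Icc (-(e₀ / D) - a (Fin.last n)) (e₁ / D - a 0) ×ˢ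
      Set.Icc 0 (1 + 2 * e₀ / det2 ν (Q.normal 0))
    have hB : IsCompact B := isCompact_Icc.prod isCompact_Icc
    have hxB : IsCompact (x '' B) := hB.image_of_continuousOn
      (hx.continuousOn.mono fun q hq => hq.2.1)
    have hyB : y ∈ x '' B := by
      rw [← hxB.isClosed.closure_eq]
      refine closure_mono ?_ (hO.inter_closure ⟨hyO, hyc⟩)
      rintro _ ⟨⟨hz0, hz1⟩, h, hr, rfl⟩
      have hr : 0 < h.2 := hr
      have hz0 : Q.ell 0 (x h) < e₀ := hz0
      have hz1 : Q.ell (Fin.last (n + 1)) (x h) < e₁ := hz1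
      have b1 := (hx.le_ell_last hN (hν _).le hr.le).trans hz1.le
      have b2 := (hx.le_ell_zero hN (hν _).le hr.le).trans hz0.le
      have b3 := (hx.le_ell hN 0 hr.le).trans hz0.le
      rw [← le_div_iff₀ hDpos] at b1 b2
      refine ⟨h, ⟨⟨by linarith, by linarith⟩, hr.le, ?_⟩, rfl⟩
      have b4 : h.2 ^ 2 ≤ 2 * e₀ / det2 ν (Q.normal 0) := by
        rw [le_div_iff₀ (hν 0)]; linarith
      nlinarith [sq_nonneg (h.2 - 1)]
    obtain ⟨⟨H, r⟩, hq, rfl⟩ := hyB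
    have hr0 : 0 ≤ r := hq.2.1
    rcases hr0.eq_or_lt with h0 | hpos
    · subst h0
      obtain ⟨j, hj⟩ := hx.exists_ell_eq_zero H
      exact absurd (hy j) (by rw [hj]; exact lt_irrefl _)
    · exact ⟨(H, r), hpos, rfl⟩

/-! ### The inverse Hessian along the action map -/

/-- In the coordinates `(H, r)`, the inverse Hessian of the potential is the quadratic form
`w ↦ r² (det(w, ξ_H)² + det(w, ξ_r)²) / (r det(ξ_H, ξ_r))`. -/
theorem IsPotential.dotProduct_inv_hess {u : Plane → ℝ} (hQ : Q.IsStrictlyUnbounded)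
    (hx : IsActionMap Q ν a x) (hu : IsPotential Q ν a x u)
    (hν : ∀ j, 0 < det2 ν (Q.normal j)) {h : ℝ × ℝ} (hr : 0 < h.2)
    (hdet : 0 < det2 (gradH Q ν a h) (radialGradR Q a h)) (w : Plane) :
    w ⬝ᵥ ((hess u (x h))⁻¹ *ᵥ w)
      = (h.2 ^ 2 * det2 w (gradH Q ν a h) ^ 2 + det2 w (radialGradR Q a h) ^ 2)
        / det2 (gradH Q ν a h) (radialGradR Q a h) := by
  set M := hess u (x h) with hM
  set V := gradH Q ν a h with hV
  set A := radialGradR Q a h with hA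
  have hr' := hr.ne'
  have himg := hx.image_eq hQ hν
  have hmem : ∀ q : ℝ × ℝ, 0 < q.2 → x q ∈ interior Q.region :=
    fun q hq => himg ▸ Set.mem_image_of_mem x hq
  have hUopen : IsOpen {q : ℝ × ℝ | 0 < q.2} := isOpen_lt continuous_const continuous_snd
  -- differentiating `∇u ∘ x = ξ`
  have hchain : ∀ k : Fin 2, ∀ p : ℝ × ℝ,
      fderiv ℝ (fun y => fderiv ℝ u y (Pi.single k 1)) (x h) (actionDeriv Q ν a h p)
        = V k * p.1 + A k / h.2 * p.2 := by
    intro k p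
    have hdiff : DifferentiableAt ℝ (fun y => fderiv ℝ u y (Pi.single k 1)) (x h) := by
      have h1 : ContDiffAt ℝ ∞ u (x h) :=
        hu.smooth.contDiffAt (isOpen_interior.mem_nhds (hmem h hr))
      have h2 : ContDiffAt ℝ 1 (fderiv ℝ u) (x h) := h1.fderiv_right (by norm_cast)
      exact (h2.differentiableAt one_ne_zero).clm_apply (differentiableAt_const _)
    have h1 := hdiff.hasFDerivAt.comp h (hx.hasFDerivAt hr)
    have h2 : (fun y => fderiv ℝ u y (Pi.single k 1)) ∘ x =ᶠ[nhds h] fun q => xi Q ν a q k := by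
      filter_upwards [hUopen.mem_nhds hr] with q hq
      simp only [Function.comp_apply]
      rw [hu.differential q hq (hmem q hq)]
      simp
    have h3 := (hasFDerivAt_xi Q ν (a := a) hr k).congr_of_eventuallyEq h2
    have := congrArg (fun L => L p) (h1.unique h3)
    simpa using this
  have hrow : ∀ (k : Fin 2) (v : Plane), fderiv ℝ (fun y => fderiv ℝ u y (Pi.single k 1)) (x h) v
      = v 0 * M 0 k + v 1 * M 1 k := by
    intro k v
    have : v = v 0 • Pi.single 0 1 + v 1 • Pi.single 1 1 := by
      ext i; fin_cases i <;> simp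
    conv_lhs => rw [this]
    simp only [map_add, map_smul, smul_eq_mul, hM, hess, Matrix.of_apply]
  have c1 : ∀ k, A 1 * M 0 k - A 0 * M 1 k = V k := by
    intro k
    have := hchain k (1, 0)
    rw [hrow] at this
    simp [actionDeriv] at this
    linarith
  have c2 : ∀ k, h.2 * (-V 1 * M 0 k + V 0 * M 1 k) = A k / h.2 := by
    intro k
    have := hchain k (0, 1)
    rw [hrow] at this
    simp [actionDeriv] at this
    linarith
  have hMdet : IsUnit M.det := by
    rw [isUnit_iff_ne_zero, Matrix.det_fin_two]
    intro h0
    have : det2 V A * (1 / h.2 ^ 2) = 0 := by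
      have e0 := c2 0
      have e1 := c2 1
      have f0 := c1 0
      have f1 := c1 1
      have a0 : A 0 * (1 / h.2 ^ 2) = -V 1 * M 0 0 + V 0 * M 1 0 := by
        field_simp at e0 ⊢; linarith
      have a1 : A 1 * (1 / h.2 ^ 2) = -V 1 * M 0 1 + V 0 * M 1 1 := by
        field_simp at e1 ⊢; linarith
      have : det2 V A * (1 / h.2 ^ 2)
          = V 0 * (A 1 * (1 / h.2 ^ 2)) - V 1 * (A 0 * (1 / h.2 ^ 2)) := by
        simp only [det2]; ring
      rw [this, a0, a1]
      linear_combination (A 1 * V 0 - A 0 * V 1) * h0 - (-V 1 * M 0 1 + V 0 * M 1 1) * f0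
        + (-V 1 * M 0 0 + V 0 * M 1 0) * f1
    have h2 : (0 : ℝ) < det2 V A * (1 / h.2 ^ 2) := by positivity
    exact h2.ne' this
  set z := M⁻¹ *ᵥ w with hz
  have hMz : M *ᵥ z = w := by
    rw [hz, Matrix.mulVec_mulVec, Matrix.mul_nonsing_inv _ hMdet, Matrix.one_mulVec]
  have hw0 : M 0 0 * z 0 + M 0 1 * z 1 = w 0 := by
    rw [← hMz]; simp [Matrix.mulVec, dotProduct, Fin.sum_univ_two]
  have hw1 : M 1 0 * z 0 + M 1 1 * z 1 = w 1 := by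
    rw [← hMz]; simp [Matrix.mulVec, dotProduct, Fin.sum_univ_two]
  have p1 : V 0 * z 0 + V 1 * z 1 = det2 w A := by
    rw [← c1 0, ← c1 1, det2, ← hw0, ← hw1]; ring
  have p2 : A 0 * z 0 + A 1 * z 1 = -h.2 ^ 2 * det2 w V := by
    have a0 : A 0 = h.2 ^ 2 * (-V 1 * M 0 0 + V 0 * M 1 0) := by
      have := c2 0; field_simp at this ⊢; linarith
    have a1 : A 1 = h.2 ^ 2 * (-V 1 * M 0 1 + V 0 * M 1 1) := by
      have := c2 1; field_simp at this ⊢; linarith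
    rw [a0, a1, det2, ← hw0, ← hw1]; ring
  rw [eq_div_iff hdet.ne', dotProduct, Fin.sum_univ_two]
  simp only [det2] at p1 p2 ⊢
  linear_combination (w 0 * A 1 - w 1 * A 0) * p1 - (w 0 * V 1 - w 1 * V 0) * p2

end actionMap

/-! ### Smooth involutions -/

/-- An involution of a vector space whose derivative at `y` is the identity is the identity near
`y`: the average of `f` with the identity is `f`-invariant and locally injective. -/
theorem eventually_eq_of_involution {E : Type*} [NormedAddCommGroup E] [NormedSpace ℝ E]
    [CompleteSpace E] {f : E → E} {y : E} (hf : HasStrictFDerivAt f (ContinuousLinearMap.id ℝ E) y)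
    (hy : f y = y) (hinv : ∀ᶠ z in nhds y, f (f z) = z) : ∀ᶠ z in nhds y, f z = z := by
  let ψ : E → E := fun z => (1 / 2 : ℝ) • (z + f z)
  have hψ : HasStrictFDerivAt ψ ((ContinuousLinearEquiv.refl ℝ E : E ≃L[ℝ] E) : E →L[ℝ] E) y := by
    refine (((hasStrictFDerivAt_id y).add hf).const_smul (1 / 2 : ℝ)).congr_fderiv ?_
    ext v
    simp only [smul_apply, add_apply,
      ContinuousLinearMap.id_apply, ContinuousLinearEquiv.coe_refl]
    module
  have hl := hψ.eventually_left_inverse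
  have hcont : Filter.Tendsto f (nhds y) (nhds y) := by
    have := hf.continuousAt.tendsto
    rwa [hy] at this
  filter_upwards [hl, hcont.eventually hl, hinv] with z h1 h2 h3
  have : ψ (f z) = ψ z := by
    simp only [ψ, h3, add_comm]
  rw [this, h1] at h2
  exact h2.symm

section Manifold

variable {X : Type*} [TopologicalSpace X] [ChartedSpace E4 X]

/-- A smooth involution of a connected manifold which fixes an open set pointwise is trivial. -/
theorem eq_self_of_involution [T2Space X] [ConnectedSpace X] [IsManifold (𝓡 4) ∞ X] {φ : X → X}
    (hφ : ContMDiff (𝓡 4) (𝓡 4) ∞ φ) (hinv : ∀ p, φ (φ p) = p)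
    (hfix : (interior {p | φ p = p}).Nonempty) (p : X) : φ p = p := by
  suffices h : interior {p | φ p = p} = Set.univ by
    have hp : p ∈ interior {p | φ p = p} := h.symm ▸ Set.mem_univ p
    have hp' : p ∈ {p | φ p = p} := interior_subset hp
    exact hp'
  refine IsClopen.eq_univ ⟨?_, isOpen_interior⟩ hfix
  refine isClosed_of_closure_subset fun p hp => ?_
  have hclosed : IsClosed {p | φ p = p} := isClosed_eq hφ.continuous continuous_id
  have hpp : φ p = p := closure_minimal interior_subset hclosed hp
  let e := extChartAt (𝓡 4) p
  let f : E4 → E4 := e ∘ φ ∘ e.symm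
  have hsrc : e.source ∈ nhds p := extChartAt_source_mem_nhds p
  have htgt : e.target ∈ nhds (e p) := extChartAt_target_mem_nhds p
  have hep : e.symm (e p) = p := extChartAt_to_inv p
  have hsymm : Filter.Tendsto e.symm (nhds (e p)) (nhds p) := by
    have := (continuousAt_extChartAt_symm (I := 𝓡 4) p).tendsto
    rwa [extChartAt_to_inv] at this
  have hφp : Filter.Tendsto φ (nhds p) (nhds p) := by
    have := hφ.continuous.tendsto p
    rwa [hpp] at this
  have hfsmooth : ContDiffAt ℝ 2 f (e p) := by
    have h1 := (contMDiffAt_iff.1 (hφ p)).2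
    rw [hpp] at h1
    have h2 : Set.range (𝓡 4) = Set.univ := by simp
    rw [h2, contDiffWithinAt_univ] at h1
    exact h1.of_le (by norm_cast)
  have hfp : f (e p) = e p := by
    simp only [f, Function.comp_apply, hep, hpp]
  have hfinv : ∀ᶠ z in nhds (e p), f (f z) = z := by
    filter_upwards [htgt, (hφp.comp hsymm).eventually hsrc] with z hz1 hz2
    simp only [f, Function.comp_apply] at hz2 ⊢
    rw [e.left_inv hz2, hinv, e.right_inv hz1]
  have hderiv : fderiv ℝ f (e p) = ContinuousLinearMap.id ℝ E4 := by
    let G : Set E4 := {y | fderiv ℝ f y = ContinuousLinearMap.id ℝ E4}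
    have hG : e p ∈ closure G := by
      have h1 : p ∈ closure (e.source ∩ interior {p | φ p = p}) := by
        rw [mem_closure_iff_nhds] at hp ⊢
        intro t ht
        obtain ⟨q, hq1, hq2⟩ := hp (t ∩ e.source) (Filter.inter_mem ht hsrc)
        exact ⟨q, hq1.1, hq1.2, hq2⟩
      refine closure_mono ?_ (mem_closure_image (continuousAt_extChartAt (I := 𝓡 4) p) h1)
      rintro _ ⟨q, ⟨hq1, hq2⟩, rfl⟩
      have h2 : f =ᶠ[nhds (e q)] id := by
        have h3 : Filter.Tendsto e.symm (nhds (e q)) (nhds q) := by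
          have := (continuousAt_extChartAt_symm' (I := 𝓡 4) hq1).tendsto
          rwa [(extChartAt (𝓡 4) p).left_inv hq1] at this
        have h4 : e.target ∈ nhds (e q) :=
          extChartAt_target_mem_nhds' (e.map_source hq1)
        filter_upwards [h4, h3.eventually (isOpen_interior.mem_nhds hq2)] with z hz1 hz2
        have hz3 : e.symm z ∈ {p | φ p = p} := interior_subset hz2
        have hz2 : φ (e.symm z) = e.symm z := hz3
        simp only [f, Function.comp_apply, hz2, e.right_inv hz1, id]
      exact (h2.fderiv_eq).trans fderiv_id
    have hcont : ContinuousAt (fderiv ℝ f) (e p) :=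
      (hfsmooth.fderiv_right (m := 1) (by norm_num)).continuousAt
    have hGclosed : IsClosed ({ContinuousLinearMap.id ℝ E4} : Set (E4 →L[ℝ] E4)) :=
      isClosed_singleton
    have := mem_closure_image hcont hG
    refine closure_minimal ?_ hGclosed this
    rintro _ ⟨y, hy, rfl⟩
    exact hy
  have hstrict := hfsmooth.hasStrictFDerivAt (by norm_num)
  rw [hderiv] at hstrict
  have hev := eventually_eq_of_involution hstrict hfp hfinv
  have hcont : Filter.Tendsto e (nhds p) (nhds (e p)) := continuousAt_extChartAt p
  rw [mem_interior_iff_mem_nhds]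
  filter_upwards [hcont.eventually hev, hsrc, hφp.eventually hsrc] with q hq1 hq2 hq3
  simp only [f, Function.comp_apply, e.left_inv hq2] at hq1
  exact e.injOn hq3 hq2 hq1

/-! ### The vector fields induced by the torus action -/

theorem torusExp_add (v w : Plane) : torusExp (v + w) = torusExp v + torusExp w := by
  funext i; simp [torusExp]

theorem torusExp_zero : torusExp 0 = 0 := by
  funext i; simp [torusExp]

theorem torusExp_zero_smul_vadd {Y : Type*} [AddAction Torus Y] (w : Plane) (p : Y) : torusExp ((0 : ℝ) • w) +ᵥ p = p := by
  rw [zero_smul, torusExp_zero, zero_vadd]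

variable [AddAction Torus X] {σ : TwoForm X} {μ : X → Plane}

theorem IsSymplecticToric.contMDiff_vadd [IsManifold (𝓡 4) ∞ X] (hX : IsSymplecticToric σ μ)
    (t : Plane) : ContMDiff (𝓡 4) (𝓡 4) ∞ (fun q : X => torusExp t +ᵥ q) :=
  hX.smooth_action.comp (contMDiff_const.prodMk contMDiff_id)

theorem IsSymplecticToric.contMDiff_orbit (hX : IsSymplecticToric σ μ)
    (w : Plane) (p : X) : ContMDiff 𝓘(ℝ, ℝ) (𝓡 4) ∞ (fun t : ℝ => torusExp (t • w) +ᵥ p) := by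
  have h1 : ContMDiff 𝓘(ℝ, ℝ) 𝓘(ℝ, Plane) ∞ (fun t : ℝ => t • w) :=
    (contDiff_id.smul contDiff_const).contMDiff
  exact hX.smooth_action.comp (h1.prodMk (contMDiff_const (c := p)))

/-- A zero of an induced vector field is a fixed point of the one-parameter subgroup. -/
theorem IsSymplecticToric.vadd_eq_of_inducedField_eq_zero [T2Space X] [IsManifold (𝓡 4) ∞ X]
    (hX : IsSymplecticToric σ μ) {w : Plane} {p : X} (h0 : inducedField w p = 0) (t : ℝ) :
    torusExp (t • w) +ᵥ p = p := by
  set γ : ℝ → X := fun t => torusExp (t • w) +ᵥ p with hγ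
  have hd0 : MDifferentiableAt 𝓘(ℝ, ℝ) (𝓡 4) γ 0 :=
    (hX.contMDiff_orbit w p).mdifferentiable (by simp) 0
  have hz : mfderiv 𝓘(ℝ, ℝ) (𝓡 4) γ 0 = 0 := by
    ext1
    exact h0
  have hγt : ∀ t, HasMFDerivAt 𝓘(ℝ, ℝ) (𝓡 4) γ t
      ((1 : ℝ →L[ℝ] ℝ).smulRight (0 : TangentSpace (𝓡 4) (γ t))) := by
    intro t
    have e : γ = (fun q : X => torusExp (t • w) +ᵥ q) ∘ γ ∘ fun s => s - t := by
      funext s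
      simp only [hγ, Function.comp_apply, vadd_vadd, ← torusExp_add, ← add_smul, add_sub_cancel]
    have h1 : HasMFDerivAt 𝓘(ℝ, ℝ) 𝓘(ℝ, ℝ) (fun s : ℝ => s - t) t
        (ContinuousLinearMap.id ℝ ℝ) := ((hasFDerivAt_id t).sub_const t).hasMFDerivAt
    have h2 : HasMFDerivAt 𝓘(ℝ, ℝ) (𝓡 4) γ (t - t) (0 : ℝ →L[ℝ] E4) := by
      rw [sub_self]
      have := hd0.hasMFDerivAt
      rw [hz] at this
      exact this
    have h3 := ((hX.contMDiff_vadd (t • w)).mdifferentiable (by simp) (γ (t - t))).hasMFDerivAt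
    have h4 := HasMFDerivAt.comp (f := fun s : ℝ => s - t) t h2 h1
    have h5 := HasMFDerivAt.comp (f := γ ∘ fun s : ℝ => s - t) t h3 h4
    have e' : (fun q : X => torusExp (t • w) +ᵥ q) ∘ γ ∘ (fun s => s - t) = γ := e.symm
    rw [e'] at h5
    have hzero : ((1 : ℝ →L[ℝ] ℝ).smulRight (0 : TangentSpace (𝓡 4) (γ t))) = 0 := by
      ext1; simp
    rw [hzero]
    let L : E4 →L[ℝ] E4 :=
      mfderiv (𝓡 4) (𝓡 4) (fun q : X => torusExp (t • w) +ᵥ q) (γ (t - t))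
    have hL : L.comp ((0 : ℝ →L[ℝ] E4).comp (ContinuousLinearMap.id ℝ ℝ)) = 0 := by simp
    exact h5.congr_mfderiv hL
  have : IsManifold (𝓡 4) 1 X := .of_le (n := ∞) (by norm_cast)
  have hv : ContMDiff (𝓡 4) (𝓡 4).tangent 1
      (fun q : X => (⟨q, 0⟩ : TangentBundle (𝓡 4) X)) := Bundle.contMDiff_zeroSection _ _
  have hconst : IsMIntegralCurve (I := 𝓡 4) (fun _ : ℝ => p)
      (fun q : X => (0 : TangentSpace (𝓡 4) q)) := by
    intro t
    have := hasMFDerivAt_const (I := 𝓘(ℝ, ℝ)) (I' := 𝓡 4) p t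
    have hzero : ((1 : ℝ →L[ℝ] ℝ).smulRight (0 : TangentSpace (𝓡 4) p)) = 0 := by
      ext1; simp
    rw [hzero]
    exact this
  have := isMIntegralCurve_Ioo_eq_of_contMDiff_boundaryless (t₀ := 0) hv hγt hconst
    (torusExp_zero_smul_vadd w p)
  exact congrFun this t

/-- Induced vector fields are smooth: they are the values of the derivative of the action map at
the constant field `(w, 0)` over `{0} × X`. -/
theorem IsSymplecticToric.contMDiff_inducedField [IsManifold (𝓡 4) ∞ X]
    (hX : IsSymplecticToric σ μ) (w : Plane) :
    ContMDiff (𝓡 4) (𝓡 4).tangent 1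
      (fun p : X => (⟨p, inducedField w p⟩ : TangentBundle (𝓡 4) X)) := by
  have : IsManifold (𝓡 4) 1 X := .of_le (n := ∞) (by norm_cast)
  have : IsManifold (𝓡 4) (1 + 1) X := .of_le (n := ∞) (by norm_cast)
  let fg : X → TangentBundle (𝓡 4) X := fun p => Bundle.TotalSpace.mk' E4 p 0
  have sfg : ContMDiff (𝓡 4) (𝓡 4).tangent 1 fg := Bundle.contMDiff_zeroSection _ _
  let fv : X → TangentBundle 𝓘(ℝ, Plane) Plane := fun _ =>
    Bundle.TotalSpace.mk' Plane ((0 : ℝ) • w) w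
  have sfv : ContMDiff (𝓡 4) 𝓘(ℝ, Plane).tangent 1 fv := contMDiff_const
  have S₁ := sfv.prodMk sfg
  have S₂ := contMDiff_equivTangentBundleProd_symm (I := 𝓘(ℝ, Plane)) (M := Plane) (I' := 𝓡 4)
    (M' := X) (n := 1)
  have S₃ := hX.smooth_action.contMDiff_tangentMap (m := 1) (by norm_cast)
  have S := (S₃.comp S₂).comp S₁
  convert! S using 1
  funext p
  have hcurve : HasMFDerivAt 𝓘(ℝ, ℝ) (𝓘(ℝ, Plane).prod (𝓡 4)) (fun t : ℝ => (t • w, p)) 0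
      (((ContinuousLinearMap.id ℝ ℝ).smulRight w).prod (0 : ℝ →L[ℝ] E4)) :=
    HasMFDerivAt.prodMk (((hasFDerivAt_id (0 : ℝ)).smul_const w).hasMFDerivAt)
      (hasMFDerivAt_const p (0 : ℝ))
  have hact := (hX.smooth_action.mdifferentiable (by simp) ((0 : ℝ) • w, p)).hasMFDerivAt
  have hcomp := (HasMFDerivAt.comp (f := fun t : ℝ => (t • w, p)) (0 : ℝ) hact hcurve).mfderiv
  let L : Plane × E4 →L[ℝ] E4 := mfderiv (𝓘(ℝ, Plane).prod (𝓡 4)) (𝓡 4)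
    (fun q : Plane × X => torusExp q.1 +ᵥ q.2) ((0 : ℝ) • w, p)
  have hval : (inducedField w p : E4) = L (w, 0) := by
    have h1 : (inducedField w p : E4) = L ((1 : ℝ) • w, 0) :=
      congrArg (fun L : ℝ →L[ℝ] E4 => L 1) hcomp
    rwa [one_smul] at h1
  have hbase : ∀ q, q = p → ∀ v : E4,
      (⟨p, v⟩ : TangentBundle (𝓡 4) X) = (⟨q, v⟩ : TangentBundle (𝓡 4) X) := by
    rintro _ rfl _; rfl
  refine (congrArg (fun v : E4 => (⟨p, v⟩ : TangentBundle (𝓡 4) X)) hval).trans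
    (hbase _ (torusExp_zero_smul_vadd w p) _)

/-- The squared length of an induced vector field is a continuous function. -/
theorem IsSymplecticToric.continuous_inner_inducedField [IsManifold (𝓡 4) ∞ X]
    (hX : IsSymplecticToric σ μ) (g : Metric X) (w : Plane) :
    Continuous fun p : X => g.inner p (inducedField w p) (inducedField w p) := by
  have h1 := hX.contMDiff_inducedField w
  have : ContMDiff (𝓡 4) 𝓘(ℝ, ℝ) 1
      fun p : X => g.inner p (inducedField w p) (inducedField w p) := by
    intro p
    have h2 := ContMDiffAt.clm_bundle_apply₂ (F₁ := E4) (F₂ := E4) (F₃ := ℝ)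
      (E₃ := Bundle.Trivial X ℝ) (ψ := g.inner) (b := fun p : X => p)
      ((g.contMDiff.of_le (n := ∞) (m := 1) (by norm_cast)) p) (h1 p) (h1 p)
    exact (Bundle.contMDiffAt_totalSpace.1 h2).2
  exact this.continuous

/-! ### The points over the interior of the polygon -/

/-- The moment image of a non-empty open set is not contained in an edge: otherwise a circle
subgroup would fix this set pointwise, and its element of order two would act trivially. -/
theorem IsSymplecticToric.dense_ell_pos [T2Space X] [ConnectedSpace X] [IsManifold (𝓡 4) ∞ X]
    (hX : IsSymplecticToric σ μ) {n : ℕ} {Q : PolygonData n} (hQ : Q.IsStrictlyUnbounded)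
    (hP : Set.range μ = Q.region) (i : Fin (n + 2)) : Dense {p : X | 0 < Q.ell i (μ p)} := by
  rw [← compl_compl {p : X | 0 < Q.ell i (μ p)}, ← interior_eq_empty_iff_dense_compl]
  by_contra hne
  rw [← ne_eq, ← Set.nonempty_iff_ne_empty] at hne
  set V := interior ({p : X | 0 < Q.ell i (μ p)}ᶜ) with hV
  have hVopen : IsOpen V := isOpen_interior
  have hell : ∀ p ∈ V, Q.ell i (μ p) = 0 := by
    intro p hp
    have h1 : p ∈ {p : X | 0 < Q.ell i (μ p)}ᶜ := interior_subset hp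
    have h2 : μ p ∈ Q.region := hP ▸ Set.mem_range_self p
    exact le_antisymm (not_lt.1 h1) (h2 i)
  have hfield : ∀ p ∈ V, inducedField (Q.normal i) p = 0 := by
    intro p hp
    apply hX.symplectic.nondegenerate
    intro v
    have h1 := hX.hamiltonian p (Q.normal i) v
    have h2 : (mfderiv (𝓡 4) 𝓘(ℝ, Plane) μ p v : Plane) ⬝ᵥ Q.normal i = 0 := by
      let D : Plane →L[ℝ] ℝ :=
        LinearMap.toContinuousLinearMap
          { toFun := fun y => y ⬝ᵥ Q.normal i
            map_add' := fun y z => add_dotProduct _ _ _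
            map_smul' := fun c y => smul_dotProduct _ _ _ }
      have h3 : HasMFDerivAt (𝓡 4) 𝓘(ℝ, ℝ) (D ∘ μ) p (D.comp (mfderiv (𝓡 4) 𝓘(ℝ, Plane) μ p)) :=
        D.hasMFDerivAt.comp p ((hX.smooth_moment.mdifferentiable (by simp) p).hasMFDerivAt)
      have h4 : D ∘ μ =ᶠ[nhds p] fun _ => -Q.lam i := by
        filter_upwards [hVopen.mem_nhds hp] with q hq
        have := hell q hq
        simp only [PolygonData.ell] at this
        show μ q ⬝ᵥ Q.normal i = -Q.lam i
        linarith
      have h5 := (hasMFDerivAt_const (I := 𝓡 4) (I' := 𝓘(ℝ, ℝ)) (-Q.lam i) p).congr_of_eventuallyEq h4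
      have h6 := hasMFDerivAt_unique h3 h5
      exact congrArg (fun L : E4 →L[ℝ] ℝ => L v) h6
    rw [h2] at h1
    have h3 := (σ p).map_swap ![v, inducedField (Q.normal i) p] (i := 0) (j := 1) (by decide)
    have h4 : ![v, inducedField (Q.normal i) p] ∘ Equiv.swap 0 1
        = ![inducedField (Q.normal i) p, v] := by
      funext k; fin_cases k <;> rfl
    rw [h4] at h3
    refine h3.trans ?_
    show -σ p ![v, inducedField (Q.normal i) p] = 0
    rw [← h1, neg_zero]
  set t : Plane := Real.pi • Q.normal i with ht
  have htt : torusExp t + torusExp t = 0 := by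
    rw [← torusExp_add]
    funext k
    show ((t + t) k : AddCircle (2 * Real.pi)) = 0
    rw [AddCircle.coe_eq_zero_iff]
    refine ⟨Q.intNormal i k, ?_⟩
    simp only [ht, PolygonData.normal, Pi.add_apply, Pi.smul_apply, smul_eq_mul, zsmul_eq_mul]
    ring
  have htriv : ∀ p : X, torusExp t +ᵥ p = p := by
    refine eq_self_of_involution (hX.contMDiff_vadd t) (fun p => ?_) ?_
    · rw [vadd_vadd, htt, zero_vadd]
    · refine hne.mono (interior_maximal (fun p hp => ?_) hVopen)
      exact hX.vadd_eq_of_inducedField_eq_zero (hfield p hp) Real.pi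
  have ht0 : torusExp t = 0 := by
    have := hX.effective
    exact eq_of_vadd_eq_vadd (P := X) fun p => by rw [htriv, zero_vadd]
  have heven : ∀ k, (2 : ℤ) ∣ Q.intNormal i k := by
    intro k
    have h1 : ((t k : ℝ) : AddCircle (2 * Real.pi)) = 0 := congrFun ht0 k
    rw [AddCircle.coe_eq_zero_iff] at h1
    obtain ⟨m, hm⟩ := h1
    refine ⟨m, ?_⟩
    simp only [ht, PolygonData.normal, Pi.smul_apply, smul_eq_mul, zsmul_eq_mul] at hm
    have h2 : Real.pi * ((2 * m : ℤ) : ℝ) = Real.pi * (Q.intNormal i k : ℝ) := by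
      push_cast; linarith
    exact_mod_cast (mul_left_cancel₀ Real.pi_ne_zero h2).symm
  have := (hQ.primitive i).isUnit_of_dvd' (heven 0) (heven 1)
  exact absurd this (by decide)

theorem IsSymplecticToric.dense_preimage_interior [T2Space X] [ConnectedSpace X]
    [IsManifold (𝓡 4) ∞ X] (hX : IsSymplecticToric σ μ) {n : ℕ} {Q : PolygonData n}
    (hQ : Q.IsStrictlyUnbounded) (hP : Set.range μ = Q.region) :
    Dense {p : X | μ p ∈ interior Q.region} := by
  have : LocallyCompactSpace X := Manifold.locallyCompact_of_finiteDimensional (𝓡 4)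
  have h1 := dense_iInter_of_isOpen (f := fun i => {p : X | 0 < Q.ell i (μ p)})
    (fun i => isOpen_lt continuous_const
      ((PolygonData.continuous_ell i).comp hX.smooth_moment.continuous))
    (hX.dense_ell_pos hQ hP)
  refine h1.mono fun p hp => ?_
  rw [hQ.interior_region]
  exact fun j => Set.mem_iInter.1 hp j

/-- In action-angle coordinates, the induced vector fields are the constant angular fields. -/
theorem IsActionAngle.inducedField_eq {P : Set Plane} {Φ : Plane × Plane → X}
    (hΦ : IsActionAngle σ μ P Φ) {y : Plane} (hy : y ∈ interior P) (θ w : Plane) :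
    inducedField w (Φ (y, θ))
      = mfderiv 𝓘(ℝ, Plane × Plane) (𝓡 4) Φ (y, θ) ((0 : Plane), w) := by
  have hΦd : MDifferentiableAt 𝓘(ℝ, Plane × Plane) (𝓡 4) Φ (y, θ + (0 : ℝ) • w) := by
    refine (hΦ.smooth.contMDiffAt ?_).mdifferentiableAt (by simp)
    exact (isOpen_interior.prod isOpen_univ).mem_nhds ⟨hy, Set.mem_univ _⟩
  have hcurve : HasMFDerivAt 𝓘(ℝ, ℝ) 𝓘(ℝ, Plane × Plane) (fun t : ℝ => (y, θ + t • w)) 0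
      ((0 : ℝ →L[ℝ] Plane).prod ((ContinuousLinearMap.id ℝ ℝ).smulRight w)) :=
    ((hasFDerivAt_const y (0 : ℝ)).prodMk
      (((hasFDerivAt_id (0 : ℝ)).smul_const w).const_add θ)).hasMFDerivAt
  have hcomp := (HasMFDerivAt.comp (f := fun t : ℝ => (y, θ + t • w)) (0 : ℝ)
    hΦd.hasMFDerivAt hcurve).mfderiv
  have e : (fun t : ℝ => torusExp (t • w) +ᵥ Φ (y, θ)) = Φ ∘ fun t : ℝ => (y, θ + t • w) := by
    funext t
    exact (hΦ.equivariant y hy θ (t • w)).symm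
  rw [← e] at hcomp
  have h1 := congrArg (fun L : ℝ →L[ℝ] E4 => L 1) hcomp
  let L : ∀ θ', Plane × Plane →L[ℝ] E4 := fun θ' => mfderiv 𝓘(ℝ, Plane × Plane) (𝓡 4) Φ (y, θ')
  have h2 : (inducedField w (Φ (y, θ)) : E4) = L (θ + (0 : ℝ) • w) (0, (1 : ℝ) • w) := h1
  rw [zero_smul, add_zero, one_smul] at h2
  exact h2

end Manifold

/-! ### Boundedness of the induced vector fields -/

section quadraticForm

variable {n : ℕ} {Q : PolygonData n} {ν : Plane} {a : Fin (n + 1) → ℝ} {x : ℝ × ℝ → Plane}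
  {u : Plane → ℝ}

theorem exists_pos_le_det2 (hν : ∀ j, 0 < det2 ν (Q.normal j)) :
    ∃ δ, 0 < δ ∧ ∀ j, δ ≤ det2 ν (Q.normal j) := by
  obtain ⟨j, hj⟩ := Finite.exists_min fun j => det2 ν (Q.normal j)
  exact ⟨_, hν j, hj⟩

theorem le_det2_gradH_radialGradR (hQ : Q.IsStrictlyUnbounded)
    (hν : ∀ j, 0 < det2 ν (Q.normal j)) (ha : StrictMono a) {δ : ℝ}
    (hδ : ∀ j, δ ≤ det2 ν (Q.normal j)) {h : ℝ × ℝ} (hr : 0 < h.2) :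
    δ ≤ det2 (gradH Q ν a h) (radialGradR Q a h) :=
  (det2_radialGradR_le Q ν ha hr hδ).trans
    (det2_le_det2_gradH Q ν ha (fun _ _ hij => (hQ.det2_neg_of_lt hν hij).le) hr)

/-- The inverse Hessian of the potential is bounded in the direction `ν`. -/
theorem IsPotential.exists_dotProduct_inv_hess_le (hQ : Q.IsStrictlyUnbounded)
    (hx : IsActionMap Q ν a x) (hu : IsPotential Q ν a x u) (hν : ∀ j, 0 < det2 ν (Q.normal j)) :
    ∃ C, ∀ y ∈ interior Q.region, ν ⬝ᵥ ((hess u y)⁻¹ *ᵥ ν) ≤ C := by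
  obtain ⟨δ, hδ0, hδ⟩ := exists_pos_le_det2 hν
  refine ⟨(totalTurn Q ν ^ 2 + (|det2 ν (Q.normal 0)| + totalTurn Q ν) ^ 2) / δ, fun y hy => ?_⟩
  rw [← hx.image_eq hQ hν] at hy
  obtain ⟨h, hr, rfl⟩ := hy
  have hr : 0 < h.2 := hr
  have hdet := le_det2_gradH_radialGradR hQ hν hx.strictMono hδ hr
  rw [hu.dotProduct_inv_hess hQ hx hν hr (hδ0.trans_le hdet)]
  have h1 := abs_mul_det2_gradH_sub_le Q ν (a := a) ν hr
  rw [det2_self, sub_zero] at h1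
  have h2 := abs_det2_radialGradR_le Q (a := a) ν hr
  have h3 : h.2 ^ 2 * det2 ν (gradH Q ν a h) ^ 2 ≤ totalTurn Q ν ^ 2 := by
    rw [← mul_pow]; exact sq_le_sq' (neg_le_of_abs_le h1) (le_of_abs_le h1)
  have h4 : det2 ν (radialGradR Q a h) ^ 2 ≤ (|det2 ν (Q.normal 0)| + totalTurn Q ν) ^ 2 :=
    sq_le_sq' (neg_le_of_abs_le h2) (le_of_abs_le h2)
  exact div_le_div₀ (by positivity) (add_le_add h3 h4) hδ0 hdet

/-- The inverse Hessian of the potential is unbounded in every direction other than `ν`: along the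
curve `H = 0` it grows like `r² det(w, ν)²`. -/
theorem IsPotential.det2_eq_zero_of_dotProduct_inv_hess_le (hQ : Q.IsStrictlyUnbounded)
    (hx : IsActionMap Q ν a x) (hu : IsPotential Q ν a x u) (hν : ∀ j, 0 < det2 ν (Q.normal j))
    {w : Plane} {C : ℝ} (hC : ∀ y ∈ interior Q.region, w ⬝ᵥ ((hess u y)⁻¹ *ᵥ w) ≤ C) :
    det2 w ν = 0 := by
  obtain ⟨δ, hδ0, hδ⟩ := exists_pos_le_det2 hν
  obtain ⟨K, hK⟩ := det2_gradH_radialGradR_le Q ν (a := a)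
  have hbound : ∀ r : ℝ, 1 ≤ r → r * |det2 w ν| ≤ |C * K| + 1 + totalTurn Q w := by
    intro r hr1
    set h : ℝ × ℝ := (0, r) with hh
    have hr : 0 < h.2 := lt_of_lt_of_le one_pos hr1
    have hdet := le_det2_gradH_radialGradR hQ hν hx.strictMono hδ hr
    have hdet0 := hδ0.trans_le hdet
    have h1 := hC (x h) (hx.image_eq hQ hν ▸ Set.mem_image_of_mem x hr)
    rw [hu.dotProduct_inv_hess hQ hx hν hr hdet0, div_le_iff₀ hdet0] at h1
    have hC0 : 0 ≤ C := by
      by_contra hneg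
      push Not at hneg
      have := mul_neg_of_neg_of_pos hneg hdet0
      have : 0 ≤ h.2 ^ 2 * det2 w (gradH Q ν a h) ^ 2 + det2 w (radialGradR Q a h) ^ 2 := by
        positivity
      linarith
    have h2 : (h.2 * |det2 w (gradH Q ν a h)|) ^ 2 ≤ |C * K| := by
      rw [mul_pow, sq_abs]
      refine le_trans ?_ (le_abs_self _)
      have := mul_le_mul_of_nonneg_left (hK h hr1) hC0
      linarith [sq_nonneg (det2 w (radialGradR Q a h))]
    have h3 : h.2 * |det2 w (gradH Q ν a h)| ≤ |C * K| + 1 := by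
      nlinarith [sq_nonneg (h.2 * |det2 w (gradH Q ν a h)| - 1)]
    have h4 := abs_mul_det2_gradH_sub_le Q ν (a := a) w hr
    rw [abs_mul, abs_of_pos hr] at h4
    have h5 := abs_sub_abs_le_abs_sub (det2 w ν) (det2 w (gradH Q ν a h))
    rw [abs_sub_comm] at h5
    have h6 := mul_le_mul_of_nonneg_left h5 hr.le
    have h7 : h.2 = r := rfl
    rw [h7] at *
    linarith
  by_contra hne
  have hpos : 0 < |det2 w ν| := abs_pos.2 hne
  have h1 := hbound (max 1 ((|C * K| + 2 + totalTurn Q w) / |det2 w ν|)) (le_max_left _ _)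
  have h2 := mul_le_mul_of_nonneg_right
    (le_max_right 1 ((|C * K| + 2 + totalTurn Q w) / |det2 w ν|)) hpos.le
  rw [div_mul_cancel₀ _ hpos.ne'] at h2
  linarith

end quadraticForm

section bounded

variable {X : Type*} [TopologicalSpace X] [ChartedSpace E4 X] [IsManifold (𝓡 4) ∞ X]
  [AddAction Torus X] {σ : TwoForm X} {μ : X → Plane}

/-- By density, the boundedness of an induced vector field may be tested in action-angle
coordinates. -/
theorem hasBoundedLength_iff [T2Space X] [ConnectedSpace X] (hX : IsSymplecticToric σ μ) {n : ℕ}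
    {Q : PolygonData n} (hQ : Q.IsStrictlyUnbounded) (hP : Set.range μ = Q.region) (g : Metric X)
    {u : Plane → ℝ} {Φ : Plane × Plane → X} (hΦ : IsActionAngle σ μ Q.region Φ)
    (hg : ∀ y ∈ interior Q.region, ∀ θ : Plane, ∀ v w : Plane × Plane,
      g.inner (Φ (y, θ)) (mfderiv 𝓘(ℝ, Plane × Plane) (𝓡 4) Φ (y, θ) v)
        (mfderiv 𝓘(ℝ, Plane × Plane) (𝓡 4) Φ (y, θ) w)
        = v.1 ⬝ᵥ (hess u y *ᵥ w.1) + v.2 ⬝ᵥ ((hess u y)⁻¹ *ᵥ w.2)) (w : Plane) :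
    HasBoundedLength g w ↔ ∃ C, ∀ y ∈ interior Q.region, w ⬝ᵥ ((hess u y)⁻¹ *ᵥ w) ≤ C := by
  have hval : ∀ y ∈ interior Q.region, ∀ θ, g.inner (Φ (y, θ)) (inducedField w (Φ (y, θ)))
      (inducedField w (Φ (y, θ))) = w ⬝ᵥ ((hess u y)⁻¹ *ᵥ w) := by
    intro y hy θ
    rw [hΦ.inducedField_eq hy, hg y hy]
    simp
  constructor
  · rintro ⟨C, hC⟩
    refine ⟨C ^ 2, fun y hy => ?_⟩
    rw [← hval y hy 0]
    exact (Real.sqrt_le_left ((Real.sqrt_nonneg _).trans (hC (Φ (y, 0))))).1 (hC _)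
  · rintro ⟨C, hC⟩
    refine ⟨Real.sqrt C, fun p => Real.sqrt_le_sqrt ?_⟩
    have hclosed : IsClosed {p : X | g.inner p (inducedField w p) (inducedField w p) ≤ C} :=
      isClosed_le (hX.continuous_inner_inducedField g w) continuous_const
    have hsub : {p : X | μ p ∈ interior Q.region}
        ⊆ {p : X | g.inner p (inducedField w p) (inducedField w p) ≤ C} := by
      intro p hp
      obtain ⟨θ, hθ⟩ := hΦ.surjective p hp
      have h1 := hval (μ p) hp θ
      rw [hθ] at h1
      exact h1.trans_le (hC _ hp)
    exact closure_minimal hsub hclosed (hX.dense_preimage_interior hQ hP p)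

end bounded

end ToricTaubNUT

theorem proposition5p4 {n : ℕ} {X : Type*} [TopologicalSpace X] [T2Space X]
    [SecondCountableTopology X] [ConnectedSpace X] [ChartedSpace ToricTaubNUT.E4 X]
    [IsManifold (𝓡 4) ∞ X] [AddAction ToricTaubNUT.Torus X]
    (σ : ToricTaubNUT.TwoForm X) (μ : X → ToricTaubNUT.Plane)
    (hX : ToricTaubNUT.IsSymplecticToric σ μ)
    (Q : ToricTaubNUT.PolygonData n) (hQ : Q.IsStrictlyUnbounded)
    (hP : Set.range μ = Q.region)
    (ν : ToricTaubNUT.Plane) (hν : ν ≠ 0)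
    (hν_first : 0 < ToricTaubNUT.det2 ν (Q.normal 0))
    (hν_last : 0 < ToricTaubNUT.det2 ν (Q.normal (Fin.last (n + 1))))
    (g : ToricTaubNUT.Metric X) (hg : ToricTaubNUT.IsMetricOf Q ν σ μ g) :
    ∀ L : Submodule ℝ ToricTaubNUT.Plane,
      (Module.finrank ℝ L = 1 ∧ ∀ w ∈ L, ToricTaubNUT.HasBoundedLength g w) ↔
        L = Submodule.span ℝ {ν} := by
  open ToricTaubNUT in
  obtain ⟨a, x, u, Φ, hx, hu, hΦ, hgΦ⟩ := hg
  have hpos := hQ.det2_pos hν_first hν_last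
  intro L
  constructor
  · rintro ⟨hL1, hL⟩
    refine Submodule.eq_of_le_of_finrank_eq (fun w hw => ?_)
      (hL1.trans (finrank_span_singleton hν).symm)
    obtain ⟨C, hC⟩ := (hasBoundedLength_iff hX hQ hP g hΦ hgΦ w).1 (hL w hw)
    have h0 := hu.det2_eq_zero_of_dotProduct_inv_hess_le hQ hx hpos hC
    exact mem_span_singleton_of_det2_eq_zero hν (by rw [det2_swap, h0, neg_zero])
  · rintro rfl
    refine ⟨finrank_span_singleton hν, fun w hw => ?_⟩
    obtain ⟨c, rfl⟩ := Submodule.mem_span_singleton.1 hw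
    obtain ⟨C, hC⟩ := hu.exists_dotProduct_inv_hess_le hQ hx hpos
    refine (hasBoundedLength_iff hX hQ hP g hΦ hgΦ _).2 ⟨c ^ 2 * C, fun y hy => ?_⟩
    rw [Matrix.mulVec_smul, dotProduct_smul, smul_dotProduct, smul_eq_mul, smul_eq_mul,
      ← mul_assoc, ← sq]
    exact mul_le_mul_of_nonneg_left (hC y hy) (sq_nonneg c)
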